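/- Conventions. Let $G$ be a discrete group with unit $e$. $G$ is amenable if it carries a left-invariant finitely additive probability measure on all of its subsets. A submultiplicative symmetric weight on $G$ is a function $\nu:G\to[1,\infty)$ with $\nu(xy)\le\nu(x)\nu(y)$ and $\nu(x^{-1})=\nu(x)$ for all $x,y\in G$. A twisted $C^*$-dynamical system $(\mathcal A,\alpha,\omega)$ with group $G$ consists of a (not necessarily unital) $C^*$-algebra $\mathcal A$, a map $\alpha:G\to\mathrm{Aut}(\mathcal A)$ into the $*$-automorphisms and a map $\omega:G\times G\to\mathcal U\mathcal M(\mathcal A)$ into the unitary group of the multiplier algebra such that, for all $x,y,z\in G$, $\alpha_x\circ\alpha_y=\mathrm{ad}_{\omega(x,y)}\circ\alpha_{xy}$, $\ \omega(x,y)\,\omega(xy,z)=\alpha_x[\omega(y,z)]\,\omega(x,yz)$ (with $\alpha_x$ extended to $\mathcal M(\mathcal A)$) and $\omega(x,e)=1=\omega(e,x)$. Given such a system and a submultiplicative symmetric weight $\nu$, let $\ell^{1,\nu}_{\alpha,\omega}(G;\mathcal A)$ be the Banach $*$-algebra of all $f:G\to\mathcal A$ with $\|f\|:=\sum_{x}\nu(x)\|f(x)\|_{\mathcal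 A}<\infty$, with product and involution $$(f\diamond g)(x)=\sum_{y\in G}f(y)\,\alpha_y[g(y^{-1}x)]\,\omega(y,y^{-1}x),\qquad f^{\diamond}(x)=\omega(x,x^{-1})^*\,\alpha_x[f(x^{-1})]^*.$$ For $\nu=1$, $\alpha_x=\mathrm{id}$ and $\omega=1$ this is the algebra $\ell^1(G;\mathcal A)\cong\ell^1(G)\widehat\otimes\mathcal A$. A Banach $*$-algebra $\mathcal B$ is symmetric if the spectrum of $b^*b$ (computed in the unitization when $\mathcal B$ has no unit) is contained in $[0,\infty)$ for every $b\in\mathcal B$. $G$ is rigidly symmetric if $\ell^1(G;\mathcal A)$ is symmetric for every $C^*$-algebra $\mathcal A$. Theorem. Let $G$ be a rigidly symmetric amenable discrete group and $\nu$ a submultiplicative symmetric weight on $G$. Assume that there is a subset $V\subseteq G$ containing $e$ which generates $G$ in the sense that $G=\bigcup_{n\ge 0}V^n$, where $V^n=\{x_1\cdots x_n: x_i\in V\}$ and $V^0=\{e\}$, such that 1. $\displaystyle\lim_{n\to\infty}\ \sup_{x_1,\dots,x_n\in V}\nu(x_1\cdots x_n)^{1/n}=1$; 2. there is a finite constant $C$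 such that $\displaystyle\sup_{x\in V^n\setminus V^{n-1}}\nu(x)\le C\inf_{x\in V^n\setminus V^{n-1}}\nu(x)$ for every $n\ge 1$ (nothing being required when $V^n\setminus V^{n-1}=\emptyset$). Then $\ell^{1,\nu}_{\alpha,\omega}(G;\mathcal A)$ is a symmetric Banach $*$-algebra for every twisted $C^*$-dynamical system $(\mathcal A,\alpha,\omega)$ with group $G$. -/

import Mathlib

open Filter Topology
open scoped Pointwise ENNReal NNReal MultiplierAlgebra

/-! ### Groups and weights -/

/-- A discrete group is amenable if it carries a left-invariant finitely additive probability
measure defined on all of its subsets. -/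
def IsAmenableGroup (G : Type*) [Group G] : Prop :=
  ∃ m : Set G → ℝ, (∀ s, 0 ≤ m s) ∧ m Set.univ = 1 ∧
    (∀ s t, Disjoint s t → m (s ∪ t) = m s + m t) ∧ ∀ (g : G) (s : Set G), m (g • s) = m s

/-- A submultiplicative, symmetric weight `ν : G → [1, ∞)`. -/
structure SymmWeight (G : Type*) [Group G] where
  toFun : G → ℝ
  one_le' : ∀ x, 1 ≤ toFun x
  mul_le' : ∀ x y, toFun (x * y) ≤ toFun x * toFun y
  inv' : ∀ x, toFun x⁻¹ = toFun x

instance SymmWeight.instCoeFun (G : Type*) [Group G] : CoeFun (SymmWeight G) (fun _ => G → ℝ) :=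
  ⟨SymmWeight.toFun⟩

/-- The constant weight `1`. -/
def SymmWeight.trivial (G : Type*) [Group G] : SymmWeight G where
  toFun := fun _ => 1
  one_le' := fun _ => le_rfl
  mul_le' := fun _ _ => by norm_num
  inv' := fun _ => rfl

namespace SymmWeight

variable {G : Type*} [Group G] (ν : SymmWeight G)

theorem pos (x : G) : 0 < ν x := lt_of_lt_of_le one_pos (ν.one_le' x)

theorem nonneg (x : G) : 0 ≤ ν x := (ν.pos x).le

end SymmWeight

/-! ### Multipliers of C*-algebras and twisted C*-dynamical systems -/

noncomputable section

/-- The extension of a `*`-automorphism `φ` of `A` to the multiplier algebra: the double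
centralizer `(L, R)` is sent to `(φ L φ⁻¹, φ R φ⁻¹)`. -/
def multiplierExtend {A : Type*} [NonUnitalCStarAlgebra A] (φ : A ≃⋆ₐ[ℂ] A) (m : 𝓜(ℂ, A)) :
    𝓜(ℂ, A) where
  fst := LinearMap.mkContinuous
    { toFun := fun a => φ (m.fst (φ.symm a))
      map_add' := fun a b => by simp
      map_smul' := fun c a => by simp } ‖m.fst‖ (fun a => by
        have h1 := NonUnitalStarAlgHom.norm_map φ φ.injective (m.fst (φ.symm a))
        have h2 := NonUnitalStarAlgHom.norm_map φ.symm φ.symm.injective a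
        have h3 := m.fst.le_opNorm (φ.symm a)
        rw [h2] at h3
        exact h1.le.trans h3)
  snd := LinearMap.mkContinuous
    { toFun := fun a => φ (m.snd (φ.symm a))
      map_add' := fun a b => by simp
      map_smul' := fun c a => by simp } ‖m.snd‖ (fun a => by
        have h1 := NonUnitalStarAlgHom.norm_map φ φ.injective (m.snd (φ.symm a))
        have h2 := NonUnitalStarAlgHom.norm_map φ.symm φ.symm.injective a
        have h3 := m.snd.le_opNorm (φ.symm a)
        rw [h2] at h3
        exact h1.le.trans h3)
  central := fun x y => by
    have h := congrArg φ (m.central (φ.symm x) (φ.symm y))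
    simpa using h

/-- A twisted C*-dynamical system `(A, α, ω)` with discrete group `G`; here `A` need not be unital
and the cocycle `ω` takes values in the unitary group of the multiplier algebra of `A`. -/
structure TwistedCStarSystem (G A : Type*) [Group G] [NonUnitalCStarAlgebra A] where
  α : G → (A ≃⋆ₐ[ℂ] A)
  ω : G → G → unitary 𝓜(ℂ, A)
  α_comp : ∀ (x y : G) (a : A), (α x (α y a) : 𝓜(ℂ, A)) =
    (ω x y : 𝓜(ℂ, A)) * (α (x * y) a : 𝓜(ℂ, A)) * star (ω x y : 𝓜(ℂ, A))
  cocycle : ∀ x y z : G, (ω x y : 𝓜(ℂ, A)) * (ω (x * y) z : 𝓜(ℂ, A)) =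
    multiplierExtend (α x) (ω y z) * (ω x (y * z) : 𝓜(ℂ, A))
  ω_one_right : ∀ x : G, ω x 1 = 1
  ω_one_left : ∀ x : G, ω 1 x = 1

namespace MultiplierFacts

variable {A : Type*} [NonUnitalCStarAlgebra A]

theorem eq_of_mul_right {a b : A} (h : ∀ c : A, a * c = b * c) : a = b := by
  have h1 : (a - b) * star (a - b) = 0 := by rw [sub_mul, h, sub_self]
  have h2 : a - b = 0 := (CStarRing.mul_star_self_eq_zero_iff _).1 h1
  exact sub_eq_zero.mp h2

theorem coe_inj {a b : A} (h : (a : 𝓜(ℂ, A)) = (b : 𝓜(ℂ, A))) : a = b := by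
  refine eq_of_mul_right fun c => ?_
  have := congrArg (fun m : 𝓜(ℂ, A) => m.fst c) h
  simpa using this

theorem ext_of_snd {m n : 𝓜(ℂ, A)} (h : ∀ a, m.snd a = n.snd a) : m = n := by
  refine DoubleCentralizer.ext ℂ A m n (Prod.ext ?_ ?_)
  · ext b
    have : ∀ c : A, c * m.fst b = c * n.fst b := fun c => by
      rw [← m.central, ← n.central, h]
    apply star_injective
    refine eq_of_mul_right fun c => ?_
    have := congrArg star (this (star c))
    simpa using this
  · ext b
    exact h b

theorem snd_mul (m : 𝓜(ℂ, A)) (a b : A) : m.snd (a * b) = a * m.snd b := by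
  refine eq_of_mul_right fun c => ?_
  rw [m.central, mul_assoc, mul_assoc, m.central]

/-- `m.snd a` is the product `a m` inside the multiplier algebra. -/
theorem coe_snd_apply (m : 𝓜(ℂ, A)) (a : A) :
    ((m.snd a : A) : 𝓜(ℂ, A)) = (a : 𝓜(ℂ, A)) * m := by
  refine ext_of_snd fun b => ?_
  simp [snd_mul]

theorem coe_mul (a b : A) : ((a * b : A) : 𝓜(ℂ, A)) = (a : 𝓜(ℂ, A)) * (b : 𝓜(ℂ, A)) :=
  map_mul (DoubleCentralizer.coeHom (𝕜 := ℂ) (A := A)) a b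

theorem coe_star (a : A) : ((star a : A) : 𝓜(ℂ, A)) = star (a : 𝓜(ℂ, A)) :=
  map_star (DoubleCentralizer.coeHom (𝕜 := ℂ) (A := A)) a

/-- `m.fst a` is the product `m a` inside the multiplier algebra. -/
theorem coe_fst_apply (m : 𝓜(ℂ, A)) (a : A) :
    ((m.fst a : A) : 𝓜(ℂ, A)) = m * (a : 𝓜(ℂ, A)) := by
  refine ext_of_snd fun b => ?_
  simp [m.central]

theorem extend_coe (φ : A ≃⋆ₐ[ℂ] A) (a : A) :
    multiplierExtend φ (a : 𝓜(ℂ, A)) = ((φ a : A) : 𝓜(ℂ, A)) := by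
  refine ext_of_snd fun b => ?_
  simp [multiplierExtend]

theorem extend_mul (φ : A ≃⋆ₐ[ℂ] A) (m n : 𝓜(ℂ, A)) :
    multiplierExtend φ (m * n) = multiplierExtend φ m * multiplierExtend φ n := by
  refine ext_of_snd fun b => ?_
  simp [multiplierExtend]

theorem extend_one (φ : A ≃⋆ₐ[ℂ] A) :
    multiplierExtend φ (1 : 𝓜(ℂ, A)) = 1 := by
  refine ext_of_snd fun b => ?_
  simp [multiplierExtend]

theorem extend_star (φ : A ≃⋆ₐ[ℂ] A) (m : 𝓜(ℂ, A)) :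
    multiplierExtend φ (star m) = star (multiplierExtend φ m) := by
  refine ext_of_snd fun b => ?_
  simp [multiplierExtend, map_star]

theorem norm_aut (φ : A ≃⋆ₐ[ℂ] A) (a : A) : ‖φ a‖ = ‖a‖ :=
  NonUnitalStarAlgHom.norm_map φ φ.injective a

theorem norm_unitary_le (u : unitary 𝓜(ℂ, A)) : ‖(u : 𝓜(ℂ, A))‖ ≤ 1 := by
  have h := CStarRing.norm_star_mul_self (x := (u : 𝓜(ℂ, A)))
  rw [Unitary.coe_star_mul_self] at h
  have h1 : ‖(1 : 𝓜(ℂ, A))‖ ≤ 1 := by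
    rw [← DoubleCentralizer.norm_snd, DoubleCentralizer.one_snd]
    exact ContinuousLinearMap.norm_id_le
  nlinarith [norm_nonneg (u : 𝓜(ℂ, A))]

theorem norm_snd_le (u : unitary 𝓜(ℂ, A)) (a : A) : ‖(u : 𝓜(ℂ, A)).snd a‖ ≤ ‖a‖ := by
  have h := (u : 𝓜(ℂ, A)).snd.le_opNorm a
  rw [DoubleCentralizer.norm_snd] at h
  nlinarith [norm_nonneg a, norm_unitary_le u]

theorem norm_fst_le (u : unitary 𝓜(ℂ, A)) (a : A) : ‖(u : 𝓜(ℂ, A)).fst a‖ ≤ ‖a‖ := by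
  have h := (u : 𝓜(ℂ, A)).fst.le_opNorm a
  rw [DoubleCentralizer.norm_fst] at h
  nlinarith [norm_nonneg a, norm_unitary_le u]

end MultiplierFacts

/-- The trivial system: identity action and cocycle `1`. -/
def TwistedCStarSystem.trivial (G A : Type*) [Group G] [NonUnitalCStarAlgebra A] :
    TwistedCStarSystem G A where
  α := fun _ => StarAlgEquiv.refl ℂ A
  ω := fun _ _ => 1
  α_comp := fun x y a => by simp
  cocycle := fun x y z => by simp [MultiplierFacts.extend_one]
  ω_one_right := fun _ => rfl
  ω_one_left := fun _ => rfl

/-! ### The weighted twisted crossed product -/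

/-- The functions `f : G → A` with `∑ ν(x) ‖f x‖ < ∞`. -/
def weightedL1 {G : Type*} [Group G] (A : Type*) [NonUnitalCStarAlgebra A] (ν : SymmWeight G) :
    Submodule ℂ (G → A) where
  carrier := {f | Summable fun x => ν x * ‖f x‖}
  zero_mem' := by simp
  add_mem' := fun {f g} hf hg => by
    refine Summable.of_nonneg_of_le (fun x => mul_nonneg (ν.nonneg x) (norm_nonneg _))
      (fun x => ?_) (hf.add hg)
    rw [← mul_add]
    exact mul_le_mul_of_nonneg_left (norm_add_le _ _) (ν.nonneg x)
  smul_mem' := fun c f hf => by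
    refine (hf.mul_left ‖c‖).congr (fun x => ?_)
    simp [norm_smul]
    ring

/-- The weighted twisted crossed product `ℓ^{1,ν}_{α,ω}(G; A)`. -/
structure TwistedCrossedProduct {G A : Type*} [Group G] [NonUnitalCStarAlgebra A]
    (S : TwistedCStarSystem G A) (ν : SymmWeight G) where
  toFun : G → A
  mem' : toFun ∈ weightedL1 A ν

namespace TwistedCrossedProduct

open MultiplierFacts

variable {G A : Type*} [Group G] [NonUnitalCStarAlgebra A]
variable {S : TwistedCStarSystem G A} {ν : SymmWeight G}

/-- The underlying vector space is the space of functions with `∑ ν(x) ‖f x‖ < ∞`, with the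
pointwise operations. -/
def equivL1 : TwistedCrossedProduct S ν ≃ weightedL1 A ν where
  toFun := fun f => ⟨f.toFun, f.mem'⟩
  invFun := fun f => ⟨f.1, f.2⟩
  left_inv := fun _ => rfl
  right_inv := fun _ => rfl

instance instAddCommGroup : AddCommGroup (TwistedCrossedProduct S ν) :=
  (equivL1 (S := S) (ν := ν)).addCommGroup

instance instModule : Module ℂ (TwistedCrossedProduct S ν) :=
  (equivL1 (S := S) (ν := ν)).module ℂ

instance instCoeFun : CoeFun (TwistedCrossedProduct S ν) (fun _ => G → A) :=
  ⟨fun f => f.toFun⟩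

theorem ext {f g : TwistedCrossedProduct S ν} (h : ∀ x, f x = g x) : f = g := by
  cases f
  cases g
  congr
  exact funext h

theorem add_apply (f g : TwistedCrossedProduct S ν) (x : G) : (f + g) x = f x + g x := rfl

theorem neg_apply (f : TwistedCrossedProduct S ν) (x : G) : (-f) x = -f x := rfl

theorem zero_apply (x : G) : (0 : TwistedCrossedProduct S ν) x = 0 := rfl

theorem smul_apply (c : ℂ) (f : TwistedCrossedProduct S ν) (x : G) : (c • f) x = c • f x := rfl

theorem summable_weight (f : TwistedCrossedProduct S ν) : Summable fun x => ν x * ‖f x‖ := f.mem'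

theorem summable_norm (f : TwistedCrossedProduct S ν) : Summable fun x => ‖f x‖ :=
  Summable.of_nonneg_of_le (fun _ => norm_nonneg _)
    (fun x => le_mul_of_one_le_left (norm_nonneg _) (ν.one_le' x)) f.summable_weight

/-- The norm `‖f‖ = ∑ ν(x) ‖f x‖`. -/
instance instNorm : Norm (TwistedCrossedProduct S ν) := ⟨fun f => ∑' x, ν x * ‖f x‖⟩

theorem norm_def (f : TwistedCrossedProduct S ν) : ‖f‖ = ∑' x, ν x * ‖f x‖ := rfl

theorem weight_mul_norm_le (f : TwistedCrossedProduct S ν) (x : G) : ν x * ‖f x‖ ≤ ‖f‖ :=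
  f.summable_weight.le_tsum x fun y _ => mul_nonneg (ν.nonneg y) (norm_nonneg _)

theorem norm_apply_le (f : TwistedCrossedProduct S ν) (x : G) : ‖f x‖ ≤ ‖f‖ :=
  (le_mul_of_one_le_left (norm_nonneg _) (ν.one_le' x)).trans (f.weight_mul_norm_le x)

instance instNormedAddCommGroup : NormedAddCommGroup (TwistedCrossedProduct S ν) :=
  { AddGroupNorm.toNormedAddCommGroup
      { toFun := fun f : TwistedCrossedProduct S ν => ‖f‖
        map_zero' := by simp [norm_def, zero_apply]
        add_le' := fun f g => by
          rw [norm_def, norm_def, norm_def, ← f.summable_weight.tsum_add g.summable_weight]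
          refine (f + g).summable_weight.tsum_le_tsum (fun x => ?_)
            (f.summable_weight.add g.summable_weight)
          rw [← mul_add]
          exact mul_le_mul_of_nonneg_left (norm_add_le _ _) (ν.nonneg x)
        neg' := fun f => by simp [norm_def, neg_apply]
        eq_zero_of_map_eq_zero' := fun f hf => by
          refine ext fun x => ?_
          have h := f.norm_apply_le x
          rw [hf] at h
          exact norm_eq_zero.1 (le_antisymm h (norm_nonneg _)) } with
    toNorm := instNorm
    toAddCommGroup := instAddCommGroup }

instance instNormedSpace : NormedSpace ℂ (TwistedCrossedProduct S ν) where
  norm_smul_le := fun c f => by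
    rw [norm_def, norm_def, ← tsum_mul_left]
    refine le_of_eq (tsum_congr fun x => ?_)
    rw [smul_apply, norm_smul]
    ring

/-- Multiplication by the weight is an isometry onto the unweighted space `ℓ¹(G; A)`. -/
def toLp (f : TwistedCrossedProduct S ν) : lp (fun _ : G => A) 1 :=
  ⟨fun x => (ν x : ℂ) • f x, by
    refine (memℓp_gen_iff (by simp)).2 ?_
    refine f.summable_weight.congr fun x => ?_
    simp [norm_smul, abs_of_pos (ν.pos x)]⟩

theorem norm_toLp (f : TwistedCrossedProduct S ν) : ‖f.toLp‖ = ‖f‖ := by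
  rw [lp.norm_eq_tsum_rpow (by simp), norm_def]
  simp [toLp, norm_smul, abs_of_pos (ν.pos _)]

instance instCompleteSpace : CompleteSpace (TwistedCrossedProduct S ν) := by
  let Φ : TwistedCrossedProduct S ν →+ lp (fun _ : G => A) 1 :=
    { toFun := toLp
      map_zero' := by
        ext x
        simp [toLp, zero_apply]
      map_add' := fun f g => by
        ext x
        exact smul_add _ _ _ }
  have hΦ : Isometry Φ := AddMonoidHomClass.isometry_of_norm Φ norm_toLp
  have hsurj : Function.Surjective Φ := fun g => by
    have hg := (memℓp_gen_iff (p := 1) (by simp)).1 g.2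
    refine ⟨⟨fun x => (ν x : ℂ)⁻¹ • g x, ?_⟩, ?_⟩
    · refine hg.congr fun x => ?_
      simp [norm_smul, abs_of_pos (ν.pos x), (ν.pos x).ne']
    · ext x
      have : (ν x : ℂ) ≠ 0 := by exact_mod_cast (ν.pos x).ne'
      change (ν x : ℂ) • ((ν x : ℂ)⁻¹ • g x) = g x
      rw [smul_smul, mul_inv_cancel₀ this, one_smul]
  exact (hΦ.isUniformInducing.completeSpace_congr hsurj).2 inferInstance

/-- The summand `f(y) α_y[g(y⁻¹x)] ω(y, y⁻¹x)` of the twisted convolution. -/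
def convTerm (S : TwistedCStarSystem G A) (f g : G → A) (x y : G) : A :=
  (S.ω y (y⁻¹ * x) : 𝓜(ℂ, A)).snd (f y * S.α y (g (y⁻¹ * x)))

/-- The twisted convolution `(f ⋄ g)(x) = ∑_y f(y) α_y[g(y⁻¹x)] ω(y, y⁻¹x)`. -/
def conv (S : TwistedCStarSystem G A) (f g : G → A) (x : G) : A :=
  ∑' y, convTerm S f g x y

/-- The twisted involution `f^⋄(x) = ω(x, x⁻¹)^* α_x[f(x⁻¹)]^*`. -/
def invol (S : TwistedCStarSystem G A) (f : G → A) (x : G) : A :=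
  (star (S.ω x x⁻¹ : 𝓜(ℂ, A))).fst (star (S.α x (f x⁻¹)))

theorem norm_convTerm_le (f g : G → A) (x y : G) :
    ‖convTerm S f g x y‖ ≤ ‖f y‖ * ‖g (y⁻¹ * x)‖ := by
  refine (norm_snd_le _ _).trans ((norm_mul_le _ _).trans ?_)
  rw [norm_aut]

theorem summable_prod (f g : TwistedCrossedProduct S ν) :
    Summable fun p : G × G => (ν p.1 * ‖f p.1‖) * (ν (p.1⁻¹ * p.2) * ‖g (p.1⁻¹ * p.2)‖) := by
  have h := Summable.mul_of_nonneg f.summable_weight g.summable_weight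
    (fun x => mul_nonneg (ν.nonneg x) (norm_nonneg _))
    (fun x => mul_nonneg (ν.nonneg x) (norm_nonneg _))
  let e : G × G ≃ G × G :=
    { toFun := fun p => (p.1, p.1⁻¹ * p.2)
      invFun := fun p => (p.1, p.1 * p.2)
      left_inv := fun p => by simp
      right_inv := fun p => by simp }
  exact (e.summable_iff).2 h

theorem weight_norm_convTerm_le (f g : G → A) (x y : G) :
    ν x * ‖convTerm S f g x y‖ ≤ (ν y * ‖f y‖) * (ν (y⁻¹ * x) * ‖g (y⁻¹ * x)‖) := by
  have h1 := norm_convTerm_le (S := S) f g x y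
  have h2 : ν x ≤ ν y * ν (y⁻¹ * x) := by
    have := ν.mul_le' y (y⁻¹ * x)
    rwa [mul_inv_cancel_left] at this
  calc ν x * ‖convTerm S f g x y‖
      ≤ (ν y * ν (y⁻¹ * x)) * (‖f y‖ * ‖g (y⁻¹ * x)‖) :=
        mul_le_mul h2 h1 (norm_nonneg _) (mul_nonneg (ν.nonneg _) (ν.nonneg _))
    _ = _ := by ring

theorem summable_weight_convTerm (f g : TwistedCrossedProduct S ν) :
    Summable fun p : G × G => ν p.2 * ‖convTerm S f g p.2 p.1‖ :=
  Summable.of_nonneg_of_le (fun _ => mul_nonneg (ν.nonneg _) (norm_nonneg _))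
    (fun _ => weight_norm_convTerm_le _ _ _ _) (summable_prod f g)

theorem summable_norm_convTerm (f g : TwistedCrossedProduct S ν) :
    Summable fun p : G × G => ‖convTerm S f g p.2 p.1‖ :=
  Summable.of_nonneg_of_le (fun _ => norm_nonneg _)
    (fun p => le_mul_of_one_le_left (norm_nonneg _) (ν.one_le' p.2)) (summable_weight_convTerm f g)

theorem summable_norm_convTerm_right (f g : TwistedCrossedProduct S ν) (x : G) :
    Summable fun y => ‖convTerm S f g x y‖ :=
  (summable_norm_convTerm f g).prod_symm.prod_factor x

theorem summable_convTerm (f g : TwistedCrossedProduct S ν) (x : G) :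
    Summable fun y => convTerm S f g x y :=
  (summable_norm_convTerm_right f g x).of_norm

theorem weight_norm_conv_le (f g : TwistedCrossedProduct S ν) (x : G) :
    ν x * ‖conv S f g x‖ ≤ ∑' y, ν x * ‖convTerm S f g x y‖ := by
  rw [tsum_mul_left]
  exact mul_le_mul_of_nonneg_left (norm_tsum_le_tsum_norm (summable_norm_convTerm_right f g x))
    (ν.nonneg x)

theorem conv_mem (f g : TwistedCrossedProduct S ν) : conv S f g ∈ weightedL1 A ν :=
  Summable.of_nonneg_of_le (fun x => mul_nonneg (ν.nonneg x) (norm_nonneg _))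
    (weight_norm_conv_le f g) (summable_weight_convTerm f g).prod_symm.prod

theorem weight_norm_invol_le (f : G → A) (x : G) :
    ν x * ‖invol S f x‖ ≤ ν x⁻¹ * ‖f x⁻¹‖ := by
  rw [ν.inv']
  refine mul_le_mul_of_nonneg_left ?_ (ν.nonneg x)
  have h := norm_fst_le (star (S.ω x x⁻¹)) (star (S.α x (f x⁻¹)))
  rwa [norm_star, norm_aut] at h

theorem summable_weight_inv (f : TwistedCrossedProduct S ν) :
    Summable fun x => ν x⁻¹ * ‖f x⁻¹‖ :=
  ((Equiv.inv G).summable_iff (f := fun x => ν x * ‖f x‖)).2 f.summable_weight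

theorem invol_mem (f : TwistedCrossedProduct S ν) : invol S f ∈ weightedL1 A ν :=
  Summable.of_nonneg_of_le (fun x => mul_nonneg (ν.nonneg x) (norm_nonneg _))
    (weight_norm_invol_le f) f.summable_weight_inv

instance instMul : Mul (TwistedCrossedProduct S ν) := ⟨fun f g => ⟨conv S f g, conv_mem f g⟩⟩

instance instStar : Star (TwistedCrossedProduct S ν) := ⟨fun f => ⟨invol S f, invol_mem f⟩⟩

theorem mul_apply (f g : TwistedCrossedProduct S ν) (x : G) :
    (f * g) x = ∑' y, convTerm S f g x y := rfl

theorem star_apply (f : TwistedCrossedProduct S ν) (x : G) :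
    (star f) x = (star (S.ω x x⁻¹ : 𝓜(ℂ, A))).fst (star (S.α x (f x⁻¹))) := rfl

/-- The automorphism `α_x` as a continuous linear map. -/
def autL (φ : A ≃⋆ₐ[ℂ] A) : A →L[ℂ] A :=
  LinearMap.mkContinuous
    { toFun := φ
      map_add' := map_add φ
      map_smul' := fun c a => by simp } 1 (fun a => by simp [norm_aut])

theorem α_one (a : A) : S.α 1 a = a := by
  have h := S.α_comp 1 1 a
  rw [S.ω_one_left] at h
  have h2 := coe_inj (by simpa using h)
  exact (S.α 1).injective h2

theorem star_mul_ω (x y : G) :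
    star (S.ω x y : 𝓜(ℂ, A)) * (S.ω x y : 𝓜(ℂ, A)) = 1 := Unitary.coe_star_mul_self _

theorem ω_mul_star (x y : G) :
    (S.ω x y : 𝓜(ℂ, A)) * star (S.ω x y : 𝓜(ℂ, A)) = 1 := Unitary.coe_mul_star_self _

theorem assoc_term (f g h : G → A) (x z w : G) :
    convTerm S (fun y => convTerm S f g y z) h x (z * w) =
      convTerm S f (fun t => convTerm S g h t w) x z := by
  apply coe_inj
  have hα := S.α_comp z w (h (w⁻¹ * (z⁻¹ * x)))
  have hc := S.cocycle z w (w⁻¹ * (z⁻¹ * x))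
  rw [mul_inv_cancel_left] at hc
  simp only [convTerm, coe_snd_apply, coe_mul, ← extend_coe (S.α z), extend_mul, mul_inv_rev,
    inv_mul_cancel_left, mul_assoc] at hα ⊢
  simp only [extend_coe] at hα ⊢
  rw [← hc, hα]
  simp only [mul_assoc]
  rw [← mul_assoc (star (S.ω z w : 𝓜(ℂ, A))), star_mul_ω, one_mul]

theorem mul_assoc_aux (f g h : TwistedCrossedProduct S ν) : f * g * h = f * (g * h) := by
  refine ext fun x => ?_
  rw [mul_apply, mul_apply]
  have hL : ∀ y, convTerm S (f * g : TwistedCrossedProduct S ν).toFun h x y =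
      ∑' z, convTerm S (fun y => convTerm S f g y z) h x y := fun y => by
    let T : A →L[ℂ] A := (S.ω y (y⁻¹ * x) : 𝓜(ℂ, A)).snd.comp
      ((ContinuousLinearMap.mul ℂ A).flip (S.α y (h (y⁻¹ * x))))
    exact T.map_tsum (summable_convTerm f g y)
  have hR : ∀ z, convTerm S f (g * h : TwistedCrossedProduct S ν).toFun x z =
      ∑' w, convTerm S f (fun t => convTerm S g h t w) x z := fun z => by
    let T : A →L[ℂ] A := (S.ω z (z⁻¹ * x) : 𝓜(ℂ, A)).snd.comp
      ((ContinuousLinearMap.mul ℂ A (f z)).comp (autL (S.α z)))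
    exact T.map_tsum (summable_convTerm g h (z⁻¹ * x))
  simp_rw [hL, hR, ← assoc_term]
  have hb : ∀ p : G × G, ‖(Function.uncurry fun y z =>
      convTerm S (fun y => convTerm S f g y z) h x y) p‖ ≤ ‖convTerm S f g p.1 p.2‖ * ‖h‖ :=
    fun p => (norm_convTerm_le (S := S) (fun y => convTerm S f g y p.2) h x p.1).trans
      (mul_le_mul_of_nonneg_left (h.norm_apply_le _) (norm_nonneg _))
  have hs : Summable (Function.uncurry fun y z =>
      convTerm S (fun y => convTerm S f g y z) h x y) :=
    Summable.of_norm_bounded (((summable_norm_convTerm f g).prod_symm).mul_right ‖h‖) hb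
  refine hs.tsum_comm.symm.trans ?_
  refine tsum_congr fun z => ?_
  exact ((Equiv.mulLeft z).tsum_eq
    (fun y => convTerm S (fun y => convTerm S f g y z) h x y)).symm

theorem star_mul_term (f g : G → A) (x z : G) :
    (star (S.ω x x⁻¹ : 𝓜(ℂ, A))).fst (star (S.α x (convTerm S f g x⁻¹ (x⁻¹ * z)))) =
      convTerm S (invol S g) (invol S f) x z := by
  apply coe_inj
  have e1 : (x⁻¹ * z)⁻¹ * x⁻¹ = z⁻¹ := by group
  have e2 : (z⁻¹ * x)⁻¹ = x⁻¹ * z := by group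
  have hα1 := S.α_comp x (x⁻¹ * z) (g z⁻¹)
  have hα2 := S.α_comp z (z⁻¹ * x) (f (x⁻¹ * z))
  have hc1 := S.cocycle x (x⁻¹ * z) z⁻¹
  have hc2 := S.cocycle z (z⁻¹ * x) (x⁻¹ * z)
  have e3 : x⁻¹ * z * z⁻¹ = x⁻¹ := by group
  have e4 : z⁻¹ * x * (x⁻¹ * z) = 1 := by group
  rw [mul_inv_cancel_left] at hα1 hα2 hc1 hc2
  rw [e3] at hc1
  rw [e4, S.ω_one_right, OneMemClass.coe_one, mul_one] at hc2
  have hc1' : multiplierExtend (S.α x) (S.ω (x⁻¹ * z) z⁻¹) =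
      (S.ω x (x⁻¹ * z) : 𝓜(ℂ, A)) * (S.ω z z⁻¹ : 𝓜(ℂ, A)) *
        star (S.ω x x⁻¹ : 𝓜(ℂ, A)) := by
    rw [hc1, mul_assoc, ω_mul_star, mul_one]
  have cancel : ∀ (u v : G) (m : 𝓜(ℂ, A)),
      star (S.ω u v : 𝓜(ℂ, A)) * ((S.ω u v : 𝓜(ℂ, A)) * m) = m := fun u v m => by
    rw [← mul_assoc, star_mul_ω, one_mul]
  simp only [convTerm, invol, e1, e2]
  simp only [coe_snd_apply, coe_fst_apply, coe_mul, coe_star, ← extend_coe (S.α x),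
    ← extend_coe (S.α z), extend_mul, extend_star]
  simp only [extend_coe]
  rw [hα1, hα2, hc1', ← hc2]
  simp only [star_mul, star_star, mul_assoc, cancel, star_mul_ω, mul_one]

theorem star_star_aux (f : TwistedCrossedProduct S ν) : star (star f) = f := by
  refine ext fun x => coe_inj ?_
  have hα := S.α_comp x x⁻¹ (f x)
  have hc := S.cocycle x x⁻¹ x
  rw [mul_inv_cancel, S.ω_one_left, inv_mul_cancel, S.ω_one_right, OneMemClass.coe_one, mul_one,
    mul_one] at hc
  rw [mul_inv_cancel, α_one] at hα
  simp only [star_apply, inv_inv]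
  simp only [coe_fst_apply, coe_star, ← extend_coe (S.α x), extend_mul, extend_star]
  simp only [extend_coe, ← hc, hα]
  simp only [star_mul, star_star, mul_assoc, star_mul_ω, mul_one]
  rw [← mul_assoc, star_mul_ω, one_mul]

theorem star_mul_aux (f g : TwistedCrossedProduct S ν) : star (f * g) = star g * star f := by
  refine ext fun x => ?_
  rw [mul_apply, star_apply, mul_apply]
  let T : A →L[ℝ] A := ((star (S.ω x x⁻¹ : 𝓜(ℂ, A))).fst.restrictScalars ℝ).comp
    ((starL' ℝ (A := A) : A →L[ℝ] A).comp ((autL (S.α x)).restrictScalars ℝ))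
  have h1 : (star (S.ω x x⁻¹ : 𝓜(ℂ, A))).fst (star (S.α x (∑' y, convTerm S f g x⁻¹ y))) =
      ∑' y, (star (S.ω x x⁻¹ : 𝓜(ℂ, A))).fst (star (S.α x (convTerm S f g x⁻¹ y))) :=
    T.map_tsum (summable_convTerm f g x⁻¹)
  rw [h1, ← (Equiv.mulLeft x⁻¹).tsum_eq]
  exact tsum_congr fun z => star_mul_term f g x z

instance instNonUnitalNormedRing : NonUnitalNormedRing (TwistedCrossedProduct S ν) :=
  { instNormedAddCommGroup, instMul with
    left_distrib := fun f g h => ext fun x => by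
      rw [add_apply, mul_apply, mul_apply, mul_apply,
        ← (summable_convTerm f g x).tsum_add (summable_convTerm f h x)]
      exact tsum_congr fun y => by simp [convTerm, add_apply, mul_add]
    right_distrib := fun f g h => ext fun x => by
      rw [add_apply, mul_apply, mul_apply, mul_apply,
        ← (summable_convTerm f h x).tsum_add (summable_convTerm g h x)]
      exact tsum_congr fun y => by simp [convTerm, add_apply, add_mul]
    zero_mul := fun f => ext fun x => by simp [mul_apply, convTerm, zero_apply]
    mul_zero := fun f => ext fun x => by simp [mul_apply, convTerm, zero_apply]
    mul_assoc := mul_assoc_aux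
    norm_mul_le := fun f g => by
      have h1 : ‖f * g‖ ≤ ∑' x, ∑' y, ν x * ‖convTerm S f g x y‖ :=
        (f * g).summable_weight.tsum_le_tsum (weight_norm_conv_le f g)
          (summable_weight_convTerm f g).prod_symm.prod
      have h2 : ∑' x, ∑' y, ν x * ‖convTerm S f g x y‖ =
          ∑' p : G × G, ν p.2 * ‖convTerm S f g p.2 p.1‖ := by
        rw [← (Equiv.prodComm G G).tsum_eq]
        exact ((summable_weight_convTerm f g).prod_symm.tsum_prod).symm
      have h3 : ∑' p : G × G, ν p.2 * ‖convTerm S f g p.2 p.1‖ ≤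
          ∑' p : G × G, (ν p.1 * ‖f p.1‖) * (ν (p.1⁻¹ * p.2) * ‖g (p.1⁻¹ * p.2)‖) :=
        (summable_weight_convTerm f g).tsum_le_tsum (fun p => weight_norm_convTerm_le _ _ _ _)
          (summable_prod f g)
      have h4 : ∑' p : G × G, (ν p.1 * ‖f p.1‖) * (ν (p.1⁻¹ * p.2) * ‖g (p.1⁻¹ * p.2)‖) =
          ‖f‖ * ‖g‖ := by
        rw [(summable_prod f g).tsum_prod, norm_def f, ← tsum_mul_right]
        refine tsum_congr fun y => ?_
        dsimp only
        rw [tsum_mul_left, norm_def g]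
        congr 1
        exact (Equiv.mulLeft y⁻¹).tsum_eq (fun t => ν t * ‖g t‖)
      exact h1.trans (h2.le.trans (h3.trans h4.le)) }

instance instStarRing : StarRing (TwistedCrossedProduct S ν) where
  star_involutive := star_star_aux
  star_mul := star_mul_aux
  star_add := fun f g => ext fun x => by simp [star_apply, add_apply]

instance instNormedStarGroup : NormedStarGroup (TwistedCrossedProduct S ν) where
  norm_star_le := fun f => by
    refine ((star f).summable_weight.tsum_le_tsum (weight_norm_invol_le f)
      f.summable_weight_inv).trans (le_of_eq ?_)
    exact (Equiv.inv G).tsum_eq (fun x => ν x * ‖f x‖)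

instance instStarModule : StarModule ℂ (TwistedCrossedProduct S ν) where
  star_smul := fun c f => ext fun x => by simp [star_apply, smul_apply]

instance instIsScalarTower :
    IsScalarTower ℂ (TwistedCrossedProduct S ν) (TwistedCrossedProduct S ν) where
  smul_assoc := fun c f g => ext fun x => by
    rw [smul_eq_mul, smul_eq_mul, smul_apply, mul_apply, mul_apply, ← tsum_const_smul'']
    exact tsum_congr fun y => by
      simp only [convTerm, smul_apply, smul_mul_assoc]
      exact map_smul _ _ _

instance instSMulCommClass :
    SMulCommClass ℂ (TwistedCrossedProduct S ν) (TwistedCrossedProduct S ν) where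
  smul_comm := fun c f g => ext fun x => by
    rw [smul_eq_mul, smul_eq_mul, smul_apply, mul_apply, mul_apply, ← tsum_const_smul'']
    exact tsum_congr fun y => by
      simp only [convTerm, smul_apply, map_smul, mul_smul_comm]

end TwistedCrossedProduct

end

/-! ### Symmetry -/

/-- A (possibly non-unital) Banach `*`-algebra `B` is symmetric if the spectrum of `b* b` is
contained in `[0, ∞)` for every `b`. The spectrum is that computed in the unitization. -/
def IsSymmetricBanachStarAlgebra (B : Type*) [NonUnitalNormedRing B] [StarRing B]
    [NormedStarGroup B] [NormedSpace ℂ B] [IsScalarTower ℂ B B] [SMulCommClass ℂ B B]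
    [StarModule ℂ B] [CompleteSpace B] : Prop :=
  ∀ b : B, ∀ z ∈ quasispectrum ℂ (star b * b), 0 ≤ z.re ∧ z.im = 0

universe u v

/-- The discrete group `G` is rigidly symmetric if `ℓ¹(G; A) ≅ ℓ¹(G) ⊗̂ A`, with the convolution
product and the standard involution, is symmetric for every C*-algebra `A`. -/
def IsRigidlySymmetric (G : Type u) [Group G] : Prop :=
  ∀ (A : Type v) [NonUnitalCStarAlgebra A],
    IsSymmetricBanachStarAlgebra
      (TwistedCrossedProduct (TwistedCStarSystem.trivial G A) (SymmWeight.trivial G))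

/-!
The regular representations induced from the GNS representations of `A` embed the system
isometrically and covariantly into an untwisted system, so that `ℓ^{1,ν}_{α,ω}(G; A)` maps into the
symmetric algebra `ℓ¹(G; C)` for some C*-algebra `C`. Symmetry is pulled back along this map as soon
as the spectral radius of `f` in the weighted algebra is at most `∑ ‖f x‖`. Applying this to the
elements `h (h - c) ^ n`, where `h = b* b`, shows that a spectral value of `h` lies in every disk
that contains the interval `[0, R]` in which the spectrum of the image of `h` is found; hence it is
a nonnegative real number.

The bound for the spectral radius follows by expanding the powers of `f` once `ν (x₁ ⋯ xₙ)` is known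
to be at most a subexponential factor times the product of the numbers `C * ν xᵢ` over those letters
`xᵢ` that are outside a given finite set. Since `log ν` is, up to a bounded error, a function `p` of
the word length, such a bound holds if word lengths behave like absolute values of integers, along
which `p` is subadditive, or if `p r ≤ p s + p t + O(1)` whenever `r`, `s`, `t` are the sides of a
triangle. The first case occurs if `p` does not tend to infinity (look at the group from a far point
where `p` is bounded) or if all balls are close to geodesics. Otherwise, a path leaving a long
geodesic together with a segment sliding along the geodesic produces, by a planar intermediate value
argument, triangles in `G` with nearly any prescribed side lengths.
-/
/-! ### Subadditive functions that are almost constant on spheres -/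

/-- The properties used here of the word length with respect to a generating set that need not be
symmetric: `ℓ x⁻¹` and `ℓ x` may differ, every element can be cut at any intermediate length, and
all lengths occur. -/
structure WordLength (G : Type*) [Group G] where
  toFun : G → ℕ
  eq_one' : ∀ x, toFun x = 0 → x = 1
  mul_le' : ∀ x y, toFun (x * y) ≤ toFun x + toFun y
  exists_mul_eq' : ∀ x m n, toFun x = m + n → ∃ y z, y * z = x ∧ toFun y = m ∧ toFun z = n
  surjective' : Function.Surjective toFun

theorem inv_mul_le_add {G : Type*} [Group G] {L : G → ℕ} (hmul : ∀ x y, L (x * y) ≤ L x + L y)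
    (x y z : G) : L (x⁻¹ * z) ≤ L (x⁻¹ * y) + L (y⁻¹ * z) := by
  simpa only [mul_assoc, mul_inv_cancel_left] using hmul (x⁻¹ * y) (y⁻¹ * z)

theorem inv_mul_le_of_steps_le {G : Type*} [Group G] {L : G → ℕ} (hone : L 1 = 0)
    (hmul : ∀ x y, L (x * y) ≤ L x + L y) {D n : ℕ} {γ : ℕ → G}
    (hγ : ∀ i < n, L ((γ i)⁻¹ * γ (i + 1)) ≤ D) {i j : ℕ} (hij : i ≤ j) (hj : j ≤ n) :
    L ((γ i)⁻¹ * γ j) ≤ D * (j - i) := by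
  induction j, hij using Nat.le_induction with
  | base => simp [hone]
  | succ j hij ih =>
    calc L ((γ i)⁻¹ * γ (j + 1)) ≤ L ((γ i)⁻¹ * γ j) + L ((γ j)⁻¹ * γ (j + 1)) :=
          inv_mul_le_add hmul _ _ _
      _ ≤ D * (j - i) + D := add_le_add (ih (by lia)) (hγ j hj)
      _ = D * (j + 1 - i) := by rw [Nat.succ_sub hij, Nat.mul_succ]

namespace WordLength

variable {G : Type*} [Group G] (ℓ : WordLength G)

instance : CoeFun (WordLength G) fun _ => G → ℕ := ⟨toFun⟩

theorem eq_one {x : G} (hx : ℓ x = 0) : x = 1 := ℓ.eq_one' x hx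

theorem mul_le (x y : G) : ℓ (x * y) ≤ ℓ x + ℓ y := ℓ.mul_le' x y

theorem exists_mul_eq {x : G} {m n : ℕ} (hx : ℓ x = m + n) :
    ∃ y z, y * z = x ∧ ℓ y = m ∧ ℓ z = n := ℓ.exists_mul_eq' x m n hx

theorem surjective : Function.Surjective ℓ := ℓ.surjective'

theorem map_one : ℓ 1 = 0 := by
  obtain ⟨x, hx⟩ := ℓ.surjective 0
  rwa [← ℓ.eq_one hx]

/-- The symmetrization `max (ℓ x) (ℓ x⁻¹)` of a word length; it controls the variation of `ℓ` under
multiplication from either side. -/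
def symm (x : G) : ℕ := max (ℓ x) (ℓ x⁻¹)

theorem symm_one : ℓ.symm 1 = 0 := by simp [symm, map_one]

theorem symm_inv (x : G) : ℓ.symm x⁻¹ = ℓ.symm x := by simp only [symm, inv_inv, max_comm]

theorem symm_mul_le (x y : G) : ℓ.symm (x * y) ≤ ℓ.symm x + ℓ.symm y := by
  have h := ℓ.mul_le x y
  have h' := ℓ.mul_le y⁻¹ x⁻¹
  simp only [symm, mul_inv_rev]
  lia

theorem symm_le_symm_mul_left (x y : G) : ℓ.symm y ≤ ℓ.symm x + ℓ.symm (x * y) := by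
  simpa only [inv_mul_cancel_left, symm_inv] using ℓ.symm_mul_le x⁻¹ (x * y)

theorem symm_le_symm_mul_right (x y : G) : ℓ.symm x ≤ ℓ.symm (x * y) + ℓ.symm y := by
  simpa only [mul_inv_cancel_right, symm_inv] using ℓ.symm_mul_le (x * y) y⁻¹

theorem dist_inv_mul_left_le (x y z : G) :
    Nat.dist (ℓ (x⁻¹ * z)) (ℓ (y⁻¹ * z)) ≤ ℓ.symm (x⁻¹ * y) := by
  have h := inv_mul_le_add ℓ.mul_le x y z
  have h' := inv_mul_le_add ℓ.mul_le y x z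
  simp only [symm, mul_inv_rev, inv_inv, Nat.dist]
  lia

theorem dist_inv_mul_right_le (x y z : G) :
    Nat.dist (ℓ (z⁻¹ * x)) (ℓ (z⁻¹ * y)) ≤ ℓ.symm (x⁻¹ * y) := by
  have h := inv_mul_le_add ℓ.mul_le z x y
  have h' := inv_mul_le_add ℓ.mul_le z y x
  simp only [symm, mul_inv_rev, inv_inv, Nat.dist]
  lia

/-- `γ` is a geodesic path on `{0, …, n}`; since `ℓ` need not be symmetric, only the lengths
in the forward direction are prescribed. -/
def IsGeodesic (n : ℕ) (γ : ℕ → G) : Prop :=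
  ∀ ⦃i j⦄, i ≤ j → j ≤ n → ℓ ((γ i)⁻¹ * γ j) = j - i

variable {ℓ}

theorem IsGeodesic.of_steps {n : ℕ} {γ : ℕ → G} (hlen : ∀ i ≤ n, ℓ (γ i) = i)
    (hstep : ∀ i < n, ℓ ((γ i)⁻¹ * γ (i + 1)) ≤ 1) : ℓ.IsGeodesic n γ := by
  intro i j hij hj
  refine le_antisymm ?_ ?_
  · simpa only [one_mul] using inv_mul_le_of_steps_le ℓ.map_one ℓ.mul_le hstep hij hj
  · have h := ℓ.mul_le (γ i) ((γ i)⁻¹ * γ j)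
    rw [mul_inv_cancel_left, hlen i (hij.trans hj), hlen j hj] at h
    lia

theorem IsGeodesic.len_eq_natAbs {n : ℕ} {γ : ℕ → G} (hγ : ℓ.IsGeodesic n γ) {i j : ℕ}
    (hi : i ≤ n) (hj : j ≤ n) :
    ℓ ((γ i)⁻¹ * γ j) = ((j : ℤ) - i).natAbs ∨ ℓ ((γ i)⁻¹ * γ j)⁻¹ = ((j : ℤ) - i).natAbs := by
  rw [mul_inv_rev, inv_inv]
  rcases le_total i j with h | h
  · exact .inl (by rw [hγ h hj]; lia)
  · exact .inr (by rw [hγ h hi]; lia)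

variable (ℓ)

theorem exists_path (x : G) : ∃ γ : ℕ → G, γ 0 = 1 ∧ γ (ℓ x) = x ∧ (∀ i ≤ ℓ x, ℓ (γ i) = i) ∧
    ∀ i < ℓ x, ℓ ((γ i)⁻¹ * γ (i + 1)) ≤ 1 := by
  induction hn : ℓ x generalizing x with
  | zero =>
    exact ⟨fun _ => 1, rfl, (ℓ.eq_one hn).symm, fun i hi => by rw [map_one, Nat.le_zero.1 hi],
      by simp⟩
  | succ n ih =>
    obtain ⟨y, z, rfl, hy, hz⟩ := ℓ.exists_mul_eq hn
    obtain ⟨γ, h0, h1, hlen, hstep⟩ := ih y hy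
    refine ⟨fun i => if i ≤ n then γ i else y * z, by simpa, by simp, fun i hi => ?_,
      fun i hi => ?_⟩
    · rcases Nat.le_succ_iff.1 hi with hi | rfl
      · simp [hi, hlen i hi]
      · simp [hn]
    · rcases Nat.lt_succ_iff_lt_or_eq.1 hi with hi | rfl
      · simpa [hi.le, Nat.succ_le_of_lt hi] using hstep i hi
      · simp [h1, hz]

theorem exists_isGeodesic_of_len (x : G) :
    ∃ γ : ℕ → G, γ 0 = 1 ∧ γ (ℓ x) = x ∧ ℓ.IsGeodesic (ℓ x) γ :=
  let ⟨γ, h0, h1, hlen, hstep⟩ := ℓ.exists_path x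
  ⟨γ, h0, h1, .of_steps hlen hstep⟩

theorem exists_isGeodesic (n : ℕ) : ∃ γ : ℕ → G, ℓ.IsGeodesic n γ := by
  obtain ⟨x, rfl⟩ := ℓ.surjective n
  obtain ⟨γ, -, -, hγ⟩ := ℓ.exists_isGeodesic_of_len x
  exact ⟨γ, hγ⟩

/-- A symmetric subadditive function on `G` whose oscillation on each sphere of `ℓ` is at
most `c`. -/
structure IsAlmostRadial (a : G → ℝ) (c : ℝ) : Prop where
  mul_le : ∀ x y, a (x * y) ≤ a x + a y
  inv : ∀ x, a x⁻¹ = a x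
  abs_sub_le_of_len_eq : ∀ ⦃x y⦄, ℓ x = ℓ y → |a x - a y| ≤ c

/-- The value of `a` at a chosen element of length `n`. -/
noncomputable def profile (a : G → ℝ) (n : ℕ) : ℝ := a (Function.surjInv ℓ.surjective n)

variable {ℓ} {a : G → ℝ} {c : ℝ}

namespace IsAlmostRadial

variable (ha : ℓ.IsAlmostRadial a c)
include ha

theorem const_nonneg : 0 ≤ c := (abs_nonneg _).trans (ha.abs_sub_le_of_len_eq (x := 1) rfl)

theorem nonneg (x : G) : 0 ≤ a x := by
  have h1 := ha.mul_le 1 1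
  have hx := ha.mul_le x x⁻¹
  rw [mul_one] at h1
  rw [mul_inv_cancel, ha.inv] at hx
  linarith

theorem abs_mul_sub_le (x y : G) : |a (x * y) - a y| ≤ a x := by
  have h := ha.mul_le x⁻¹ (x * y)
  rw [inv_mul_cancel_left, ha.inv] at h
  exact abs_sub_le_iff.2 ⟨by linarith [ha.mul_le x y], by linarith⟩

theorem abs_inv_mul_mul_sub_le (x y z : G) : |a (x⁻¹ * (y * z)) - a y| ≤ a x + a z := by
  have hx := ha.abs_mul_sub_le x⁻¹ (y * z)
  have hz := ha.abs_mul_sub_le z⁻¹ y⁻¹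
  rw [← mul_inv_rev, ha.inv, ha.inv, ha.inv] at hz
  rw [ha.inv] at hx
  linarith [abs_sub_le (a (x⁻¹ * (y * z))) (a (y * z)) (a y)]

theorem profile_nonneg (n : ℕ) : 0 ≤ ℓ.profile a n := ha.nonneg _

theorem abs_sub_profile_le {x : G} {n : ℕ} (hx : ℓ x = n) : |a x - ℓ.profile a n| ≤ c :=
  ha.abs_sub_le_of_len_eq (hx.trans (Function.surjInv_eq ℓ.surjective n).symm)

theorem abs_sub_profile_le' {x : G} {n : ℕ} (hx : ℓ x = n ∨ ℓ x⁻¹ = n) :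
    |a x - ℓ.profile a n| ≤ c :=
  hx.elim ha.abs_sub_profile_le fun h => ha.inv x ▸ ha.abs_sub_profile_le h

theorem abs_sub_profile_symm_le (x : G) : |a x - ℓ.profile a (ℓ.symm x)| ≤ c :=
  ha.abs_sub_profile_le' <| (max_choice (ℓ x) (ℓ x⁻¹)).imp Eq.symm Eq.symm

theorem le_partialSups_add {x : G} {n : ℕ} (hx : ℓ x ≤ n) :
    a x ≤ partialSups (ℓ.profile a) n + c := by
  linarith [(abs_le.1 (ha.abs_sub_profile_le (x := x) rfl)).2,
    le_partialSups_of_le (ℓ.profile a) hx]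

theorem profile_add_le (m n : ℕ) :
    ℓ.profile a (m + n) ≤ ℓ.profile a m + ℓ.profile a n + 3 * c := by
  obtain ⟨x, hx⟩ := ℓ.surjective (m + n)
  obtain ⟨y, z, rfl, hy, hz⟩ := ℓ.exists_mul_eq hx
  linarith [(abs_le.1 (ha.abs_sub_profile_le hx)).1, (abs_le.1 (ha.abs_sub_profile_le hy)).2,
    (abs_le.1 (ha.abs_sub_profile_le hz)).2, ha.mul_le y z]

theorem profile_le_profile_add (m n : ℕ) :
    ℓ.profile a m ≤ ℓ.profile a (m + n) + ℓ.profile a n + 3 * c := by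
  obtain ⟨x, hx⟩ := ℓ.surjective (m + n)
  obtain ⟨y, z, rfl, hy, hz⟩ := ℓ.exists_mul_eq hx
  have h := ha.mul_le (y * z) z⁻¹
  rw [mul_inv_cancel_right, ha.inv] at h
  linarith [(abs_le.1 (ha.abs_sub_profile_le hx)).2, (abs_le.1 (ha.abs_sub_profile_le hy)).1,
    (abs_le.1 (ha.abs_sub_profile_le hz)).2]

theorem profile_natAbs_add_le (k l : ℤ) : ℓ.profile a (k + l).natAbs ≤
    ℓ.profile a k.natAbs + ℓ.profile a l.natAbs + 3 * c := by
  have h : (k + l).natAbs = k.natAbs + l.natAbs ∨ k.natAbs = (k + l).natAbs + l.natAbs ∨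
      l.natAbs = (k + l).natAbs + k.natAbs := by lia
  rcases h with h | h | h
  · exact h ▸ ha.profile_add_le _ _
  · exact h ▸ ha.profile_le_profile_add _ _
  · linarith [h ▸ ha.profile_le_profile_add (k + l).natAbs k.natAbs]

theorem abs_profile_natAbs_add_sub_le (k l : ℤ) :
    |ℓ.profile a (k + l).natAbs - ℓ.profile a l.natAbs| ≤ ℓ.profile a k.natAbs + 3 * c := by
  have h := ha.profile_natAbs_add_le (-k) (k + l)
  rw [neg_add_cancel_left, Int.natAbs_neg] at h
  exact abs_sub_le_iff.2 ⟨by linarith [ha.profile_natAbs_add_le k l], by linarith⟩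

theorem abs_profile_sub_profile_le {m n R : ℕ} (h : Nat.dist m n ≤ R) :
    |ℓ.profile a m - ℓ.profile a n| ≤ partialSups (ℓ.profile a) R + 3 * c := by
  have h' := ha.abs_profile_natAbs_add_sub_le (m - n) n
  rw [sub_add_cancel, Int.natAbs_natCast, Int.natAbs_natCast] at h'
  refine h'.trans (add_le_add_left (le_partialSups_of_le _ ?_) _)
  simp only [Nat.dist] at h
  lia

/-- When the profile tends to infinity, `ℓ` and its symmetrization are comparable, because `a` is
symmetric. -/
theorem exists_symm_le (h : Tendsto (ℓ.profile a) atTop atTop) (n : ℕ) :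
    ∃ m, ∀ x, ℓ x ≤ n → ℓ.symm x ≤ m := by
  obtain ⟨m, hm⟩ := (tendsto_atTop.1 h
    (partialSups (ℓ.profile a) n + 2 * c + 1)).exists_forall_of_atTop
  refine ⟨m, fun x hx => ?_⟩
  by_contra! hlt
  linarith [hm _ hlt.le, (abs_le.1 (ha.abs_sub_profile_symm_le x)).1, ha.le_partialSups_add hx]

end IsAlmostRadial

variable (ℓ a)

/-- Subadditivity of `a` along words in which the letters from a finite set cost nothing, up to an
error depending only on the number of letters. -/
def HasWordBound : Prop :=
  ∃ C : ℝ, ∀ E : Finset G, ∃ K : ℕ, ∀ l : List G,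
    a l.prod ≤ (l.map ((E : Set G)ᶜ.indicator fun x => a x + C)).sum +
      partialSups (ℓ.profile a) (K * l.length) + C

/-- On finite sets `a (y⁻¹ * y')` is, up to a constant, a function of the distance of images in the
integers, and this distance is controlled by `y⁻¹ * y'`. -/
def EmbedsInLine : Prop :=
  ∃ (C : ℝ) (κ : G → ℕ), ∀ S : Finset G, ∃ i : G → ℤ, ∀ y ∈ S, ∀ y' ∈ S,
    |a (y⁻¹ * y') - ℓ.profile a (i y' - i y).natAbs| ≤ C ∧ (i y' - i y).natAbs ≤ κ (y⁻¹ * y')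

/-- The triangle inequality for the profile on all triples of lengths that form a triangle. -/
def HasTriangles : Prop :=
  ∃ H : ℝ, ∀ p q r : ℕ, r ≤ p + q → p ≤ q + r → q ≤ p + r →
    ℓ.profile a r ≤ ℓ.profile a p + ℓ.profile a q + H

/-- Arbitrarily large balls lie in a uniform neighbourhood of a geodesic. -/
def IsLinelike : Prop :=
  ∃ W : ℕ, ∀ s : ℕ, ∃ (n k : ℕ) (γ : ℕ → G), k ≤ n ∧ ℓ.IsGeodesic n γ ∧
    ∀ g, ℓ g ≤ s → ∃ i ≤ n, ℓ ((γ i)⁻¹ * (γ k * g)) ≤ W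

variable {ℓ a}

theorem exists_displacement_eq_add (ha : ℓ.IsAlmostRadial a c) {C C' : ℝ} {κ : G → ℕ}
    (hC : C + 3 * c ≤ C') {S : Finset G} {i : G → ℤ}
    (hi : ∀ y ∈ S, ∀ y' ∈ S, |a (y⁻¹ * y') - ℓ.profile a (i y' - i y).natAbs| ≤ C ∧
      (i y' - i y).natAbs ≤ κ (y⁻¹ * y'))
    (E : Finset G) (l : List G) (hl : ∀ p, p <+: l → p.prod ∈ S) :
    ∃ s t : ℤ, i l.prod - i 1 = s + t ∧ s.natAbs ≤ E.sup κ * l.length ∧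
      ℓ.profile a t.natAbs ≤
        (l.map ((E : Set G)ᶜ.indicator fun x => a x + C')).sum + ℓ.profile a 0 := by
  induction l using List.reverseRecOn with
  | nil => exact ⟨0, 0, by simp⟩
  | append_singleton l x ih =>
    obtain ⟨s, t, hst, hs, ht⟩ := ih fun p hp => hl p (hp.trans (List.prefix_append l [x]))
    have hx := hi _ (hl l (List.prefix_append l [x])) _ (hl _ (List.prefix_refl _))
    simp only [List.prod_append, List.prod_singleton, inv_mul_cancel_left] at hx
    simp only [List.prod_append, List.prod_singleton, List.length_append, List.length_singleton,
      mul_add, mul_one, List.map_append, List.sum_append, List.map_singleton, List.sum_singleton]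
    by_cases hxE : x ∈ E
    · have hκ : κ x ≤ E.sup κ := Finset.le_sup hxE
      refine ⟨s + (i (l.prod * x) - i l.prod), t, by lia, by lia, ?_⟩
      rw [Set.indicator_of_notMem (by simpa), add_zero]
      exact ht
    · refine ⟨s, t + (i (l.prod * x) - i l.prod), by lia, by lia, ?_⟩
      rw [Set.indicator_of_mem (by simpa)]
      linarith [ha.profile_natAbs_add_le t (i (l.prod * x) - i l.prod), (abs_le.1 hx.1).1]

theorem EmbedsInLine.hasWordBound (ha : ℓ.IsAlmostRadial a c) (h : ℓ.EmbedsInLine a) :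
    ℓ.HasWordBound a := by
  classical
  obtain ⟨C, κ, h⟩ := h
  have h0 := ha.profile_nonneg 0
  refine ⟨C + ℓ.profile a 0 + 3 * c, fun E => ⟨E.sup κ, fun l => ?_⟩⟩
  obtain ⟨i, hi⟩ := h (l.inits.map List.prod).toFinset
  have hmem : ∀ p, p <+: l → p.prod ∈ (l.inits.map List.prod).toFinset := fun p hp =>
    List.mem_toFinset.2 (List.mem_map_of_mem ((List.mem_inits p l).2 hp))
  obtain ⟨s, t, hst, hs, ht⟩ := exists_displacement_eq_add ha
    (by linarith : C + 3 * c ≤ C + ℓ.profile a 0 + 3 * c) hi E l hmem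
  have hl := (hi _ (hmem [] List.nil_prefix) _ (hmem l (List.prefix_refl l))).1
  rw [List.prod_nil, hst, inv_one, one_mul] at hl
  linarith [(abs_le.1 hl).2, ha.profile_natAbs_add_le s t,
    le_partialSups_of_le (ℓ.profile a) hs]

end WordLength
theorem exists_window_of_frequently {P : ℕ → Prop} (hP : ∃ᶠ L in atTop, P L) (R M : ℕ) :
    ∃ N, ∀ f : ℕ → ℕ, MonotoneOn f (Set.Iic N) → f N ≤ M →
      ∃ L, P L ∧ R ≤ L ∧ L + R ≤ N ∧ f (L - R) = f (L + R) := by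
  rw [frequently_atTop] at hP
  induction M with
  | zero =>
    obtain ⟨L, hL, hPL⟩ := hP R
    refine ⟨L + R, fun f hf h0 => ⟨L, hPL, hL, le_rfl, ?_⟩⟩
    have := hf (a := L - R) (b := L + R) (by grind) (by simp) (by lia)
    lia
  | succ M ih =>
    obtain ⟨N, hN⟩ := ih
    obtain ⟨L, hL, hPL⟩ := hP (N + R)
    refine ⟨L + R, fun f hf hM => ?_⟩
    by_cases h : f (L - R) = f (L + R)
    · exact ⟨L, hPL, by lia, le_rfl, h⟩
    · have h1 := hf (a := L - R) (b := L + R) (by grind) (by simp) (by lia)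
      have h2 := hf (a := N) (b := L - R) (by grind) (by grind) (by lia)
      obtain ⟨L', hL', hR, hLN, hf'⟩ :=
        hN f (hf.mono (Set.Iic_subset_Iic.2 (by lia))) (by lia)
      exact ⟨L', hL', hR, by lia, hf'⟩

namespace WordLength

variable {G : Type*} [Group G] {ℓ : WordLength G} {a : G → ℝ} {c : ℝ}

theorem exists_backward_geodesic (ℓ : WordLength G) (N : ℕ) :
    ∃ Γ : ℕ → G, Γ 0 = 1 ∧ ∀ i j, i ≤ j → j ≤ N → ℓ (Γ j * (Γ i)⁻¹) = j - i := by
  obtain ⟨γ, hγ⟩ := ℓ.exists_isGeodesic N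
  refine ⟨fun i => (γ (N - i))⁻¹ * γ N, by simp, fun i j hij hj => ?_⟩
  rw [mul_inv_rev, inv_inv, mul_assoc, mul_inv_cancel_left, hγ (by lia) (by lia)]
  lia

/-- Along a backward geodesic `Γ` the defects `i + ℓ y - ℓ (Γ i * y)` increase and stay bounded, so
they are constant on a long window. -/
theorem exists_stable_window (ℓ : WordLength G) {P : ℕ → Prop} (hP : ∃ᶠ L in atTop, P L)
    (S : Finset G) (R : ℕ) : ∃ (Γ : ℕ → G) (b : G → ℤ) (L : ℕ), P L ∧ R ≤ L ∧
      (∀ i, L - R ≤ i → i ≤ L + R → ℓ (Γ i) = i) ∧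
      ∀ y ∈ S, ∀ i, L - R ≤ i → i ≤ L + R → (ℓ (Γ i * y) : ℤ) = i + b y := by
  obtain ⟨N, hN⟩ := exists_window_of_frequently hP R (∑ y ∈ S, (ℓ y + ℓ y⁻¹))
  obtain ⟨Γ, hΓ0, hΓ⟩ := ℓ.exists_backward_geodesic N
  have hlen : ∀ i ≤ N, ℓ (Γ i) = i := fun i hi => by
    simpa [hΓ0] using hΓ 0 i i.zero_le hi
  have hup : ∀ i ≤ N, ∀ y, ℓ (Γ i * y) ≤ i + ℓ y := fun i hi y => by
    simpa only [hlen i hi] using ℓ.mul_le (Γ i) y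
  have hmono : ∀ y, MonotoneOn (fun i => i + ℓ y - ℓ (Γ i * y)) (Set.Iic N) :=
    fun y i hi j hj hij => by
      have h := ℓ.mul_le (Γ j * (Γ i)⁻¹) (Γ i * y)
      rw [hΓ i j hij hj, mul_assoc, inv_mul_cancel_left] at h
      have := hup i hi y
      have := hup j hj y
      lia
  obtain ⟨L, hPL, hRL, hLN, hsum⟩ := hN (fun i => ∑ y ∈ S, (i + ℓ y - ℓ (Γ i * y)))
    (fun i hi j hj hij => Finset.sum_le_sum fun y _ => hmono y hi hj hij)
    (Finset.sum_le_sum fun y _ => by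
      have h := ℓ.mul_le (Γ N * y) y⁻¹
      rw [mul_inv_cancel_right, hlen N le_rfl] at h
      lia)
  have hends := (Finset.sum_eq_sum_iff_of_le fun y _ =>
    hmono y (a := L - R) (b := L + R) (by grind) (by grind) (by lia)).1 hsum
  refine ⟨Γ, fun y => ℓ (Γ L * y) - L, L, hPL, hRL, fun i _ hi => hlen i (by lia),
    fun y hy i h1 h2 => ?_⟩
  have := hends y hy
  have := hmono y (a := L - R) (b := i) (by grind) (by grind) h1
  have := hmono y (a := i) (b := L + R) (by grind) (by grind) h2
  have := hmono y (a := L - R) (b := L) (by grind) (by grind) (by lia)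
  have := hmono y (a := L) (b := L + R) (by grind) (by grind) (by lia)
  have := hup i (by lia) y
  have := hup L (by lia) y
  lia

theorem exists_busemann (ℓ : WordLength G) {P : ℕ → Prop} (hP : ∃ᶠ L in atTop, P L)
    (S : Finset G) : ∃ b : G → ℤ, ∀ y ∈ S, ∀ y' ∈ S,
      ∃ u, P (ℓ u) ∧ (ℓ (u * (y⁻¹ * y')) : ℤ) = ℓ u + (b y' - b y) := by
  obtain ⟨Γ, b, L, hPL, hRL, hΓ, hb⟩ := ℓ.exists_stable_window hP S (S.sup ℓ.symm)
  refine ⟨b, fun y hy y' hy' => ?_⟩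
  have hby : b y ≤ ℓ.symm y ∧ -(ℓ.symm y : ℤ) ≤ b y := by
    have h := ℓ.mul_le (Γ L) y
    have h' := ℓ.mul_le (Γ L * y) y⁻¹
    rw [mul_inv_cancel_right] at h'
    have := hb y hy L (by lia) (by lia)
    rw [hΓ L (by lia) (by lia)] at h h'
    simp only [symm]
    lia
  have hyS : ℓ.symm y ≤ S.sup ℓ.symm := Finset.le_sup hy
  lift (L : ℤ) - b y to ℕ using by lia with i hi
  have hu := hb y hy i (by lia) (by lia)
  have hu' := hb y' hy' i (by lia) (by lia)
  have hL : ℓ (Γ i * y) = L := by lia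
  refine ⟨Γ i * y, hL ▸ hPL, ?_⟩
  rw [mul_assoc, mul_inv_cancel_left]
  lia

theorem IsAlmostRadial.embedsInLine_of_frequently (ha : ℓ.IsAlmostRadial a c) {B : ℝ}
    (hB : ∃ᶠ L in atTop, ℓ.profile a L ≤ B) : ℓ.EmbedsInLine a := by
  refine ⟨2 * B + 5 * c, ℓ.symm, fun S => ?_⟩
  obtain ⟨b, hb⟩ := ℓ.exists_busemann hB S
  refine ⟨b, fun y hy y' hy' => ?_⟩
  obtain ⟨u, huB, hu⟩ := hb y hy y' hy'
  set w := y⁻¹ * y'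
  set d := b y' - b y
  constructor
  · have hau := (abs_sub_le_iff.1 (ha.abs_sub_profile_le (x := u) rfl)).1
    have hauw := abs_sub_le_iff.1 (ha.abs_mul_sub_le u w)
    have hfuw := abs_sub_le_iff.1 (ha.abs_sub_profile_le (x := u * w) rfl)
    have hfd := abs_sub_le_iff.1 (ha.abs_profile_natAbs_add_sub_le (ℓ u) d)
    rw [← hu, Int.natAbs_natCast, Int.natAbs_natCast] at hfd
    exact abs_sub_le_iff.2 ⟨by linarith [hauw.2, hfuw.1, hfd.1],
      by linarith [hauw.1, hfuw.2, hfd.2]⟩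
  · have h := ℓ.dist_inv_mul_right_le 1 w u⁻¹
    simp only [inv_inv, inv_one, one_mul, mul_one, Nat.dist] at h
    lia

theorem IsLinelike.embedsInLine (ha : ℓ.IsAlmostRadial a c) (hL : ℓ.IsLinelike)
    (hf : Tendsto (ℓ.profile a) atTop atTop) : ℓ.EmbedsInLine a := by
  obtain ⟨W, hW⟩ := hL
  obtain ⟨M, hM⟩ := ha.exists_symm_le hf W
  refine ⟨2 * partialSups (ℓ.profile a) W + 3 * c, fun g => 2 * M + ℓ.symm g, fun S => ?_⟩
  obtain ⟨n, k, γ, -, hγ, hnear⟩ := hW (S.sup ℓ)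
  have hnear' : ∀ y ∈ S, ∃ i ≤ n, ℓ ((γ i)⁻¹ * (γ k * y)) ≤ W := fun y hy =>
    hnear y (Finset.le_sup (f := ℓ) hy)
  choose! i hi hρ using hnear'
  refine ⟨fun y => i y, fun y hy y' hy' => ?_⟩
  let ρ : G → G := fun y => (γ (i y))⁻¹ * (γ k * y)
  let τ := (γ (i y))⁻¹ * γ (i y')
  have hτ := hγ.len_eq_natAbs (hi y hy) (hi y' hy')
  have hyy' : y⁻¹ * y' = (ρ y)⁻¹ * (τ * ρ y') := by simp only [ρ, τ]; group
  have hτ' : τ = ρ y * ((y⁻¹ * y') * (ρ y')⁻¹) := by rw [hyy']; group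
  constructor
  · have h := ha.abs_inv_mul_mul_sub_le (ρ y) τ (ρ y')
    rw [← hyy'] at h
    linarith [abs_sub_le (a (y⁻¹ * y')) (a τ) (ℓ.profile a ((i y' : ℤ) - i y).natAbs),
      ha.abs_sub_profile_le' hτ, ha.le_partialSups_add (hρ y hy),
      ha.le_partialSups_add (hρ y' hy')]
  · calc ((i y' : ℤ) - i y).natAbs ≤ ℓ.symm τ := le_max_iff.2 (hτ.imp Eq.ge Eq.ge)
      _ ≤ ℓ.symm (ρ y) + (ℓ.symm (y⁻¹ * y') + ℓ.symm (ρ y')⁻¹) := by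
        rw [hτ']
        exact (ℓ.symm_mul_le _ _).trans (add_le_add_right (ℓ.symm_mul_le _ _) _)
      _ ≤ 2 * M + ℓ.symm (y⁻¹ * y') := by
        have := hM _ (hρ y hy)
        have := hM _ (hρ y' hy')
        rw [symm_inv]
        lia

end WordLength
theorem sum_range_eq_of_cells {M : Type*} [AddCommGroup M] {h v : ℕ → ℕ → M} {I m : ℕ}
    (hcell : ∀ i < I, ∀ t < m, h i (t + 1) - h i t = v (i + 1) t - v i t)
    (hleft : ∀ t < m, v 0 t = 0) (hright : ∀ t < m, v I t = 0) :
    ∑ i ∈ Finset.range I, h i m = ∑ i ∈ Finset.range I, h i 0 := by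
  induction m with
  | zero => rfl
  | succ m ih =>
    rw [← ih (fun i hi t ht => hcell i hi t (by lia)) (fun t ht => hleft t (by lia))
      (fun t ht => hright t (by lia)), ← sub_eq_zero, ← Finset.sum_sub_distrib,
      Finset.sum_congr rfl fun i hi => hcell i (Finset.mem_range.1 hi) m m.lt_succ_self,
      Finset.sum_range_sub (fun i => v i m), hleft m m.lt_succ_self, hright m m.lt_succ_self,
      sub_zero]

/-- `f` varies by at most `D` along the edges of the grid `{0, …, I} × {0, …, m}`. -/
structure IsGridLipschitz (D I m : ℕ) (f : ℕ → ℕ → ℕ) : Prop where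
  horizontal : ∀ i < I, ∀ t ≤ m, Nat.dist (f i t) (f (i + 1) t) ≤ D
  vertical : ∀ i ≤ I, ∀ t < m, Nat.dist (f i t) (f i (t + 1)) ≤ D

/-- The indicator function of the sublevel set `{f < q}` of a function on a grid. -/
def gridIndicator (f : ℕ → ℕ → ℕ) (q i t : ℕ) : ℤ := if f i t < q then 1 else 0

theorem gridIndicator_of_le {f : ℕ → ℕ → ℕ} {q i t : ℕ} (h : q ≤ f i t) :
    gridIndicator f q i t = 0 := if_neg h.not_gt

theorem gridIndicator_of_lt {f : ℕ → ℕ → ℕ} {q i t : ℕ} (h : f i t < q) :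
    gridIndicator f q i t = 1 := if_pos h

theorem IsGridLipschitz.gridIndicator_eq {D I m q : ℕ} {f : ℕ → ℕ → ℕ}
    (hf : IsGridLipschitz D I m f) {i t : ℕ} (hi : i < I) (ht : t < m)
    (hq : 2 * D < Nat.dist (f i t) q) :
    gridIndicator f q (i + 1) t = gridIndicator f q i t ∧
      gridIndicator f q i (t + 1) = gridIndicator f q i t ∧
      gridIndicator f q (i + 1) (t + 1) = gridIndicator f q i t := by
  have h1 := hf.horizontal i hi t ht.le
  have h2 := hf.vertical i hi.le t ht
  have h3 := hf.vertical (i + 1) hi t ht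
  simp only [Nat.dist] at hq h1 h2 h3
  refine ⟨?_, ?_, ?_⟩ <;> exact if_congr (by lia) rfl rfl

/-- A discrete form of `d(dA ∧ B) = 0`, valid where one of the two functions is locally constant:
it turns the existence of a common point of `f ≈ q` and `e ≈ P` into a boundary condition. -/
theorem gridIndicator_cell {D I m q P : ℕ} {f e : ℕ → ℕ → ℕ} (hf : IsGridLipschitz D I m f)
    (he : IsGridLipschitz D I m e) {i t : ℕ} (hi : i < I) (ht : t < m)
    (h : Nat.dist (f i t) q ≤ 2 * D → 2 * D < Nat.dist (e i t) P) :
    (gridIndicator f q (i + 1) (t + 1) - gridIndicator f q i (t + 1)) *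
        gridIndicator e P i (t + 1) -
      (gridIndicator f q (i + 1) t - gridIndicator f q i t) * gridIndicator e P i t =
    (gridIndicator f q (i + 1) (t + 1) - gridIndicator f q (i + 1) t) *
        gridIndicator e P (i + 1) t -
      (gridIndicator f q i (t + 1) - gridIndicator f q i t) * gridIndicator e P i t := by
  rcases le_or_gt (Nat.dist (f i t) q) (2 * D) with hfq | hfq
  · obtain ⟨h1, h2, -⟩ := he.gridIndicator_eq hi ht (h hfq)
    rw [h1, h2]
    ring
  · obtain ⟨h1, h2, h3⟩ := hf.gridIndicator_eq hi ht hfq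
    rw [h1, h2, h3]
    ring

theorem sum_gridIndicator_bottom {q P I j k : ℕ} {f e : ℕ → ℕ → ℕ} (hjk : j < k) (hkI : k ≤ I)
    (hfj : ∀ i ≤ j, q ≤ f i 0) (hfk : ∀ i, j < i → i ≤ k → f i 0 < q) (hej : e j 0 < P)
    (hek : ∀ i, k ≤ i → i ≤ I → P ≤ e i 0) :
    ∑ i ∈ Finset.range I,
      (gridIndicator f q (i + 1) 0 - gridIndicator f q i 0) * gridIndicator e P i 0 = 1 := by
  rw [Finset.sum_eq_single_of_mem j (Finset.mem_range.2 (hjk.trans_le hkI))]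
  · rw [gridIndicator_of_le (hfj j le_rfl), gridIndicator_of_lt (hfk _ j.lt_succ_self hjk),
      gridIndicator_of_lt hej, sub_zero, one_mul]
  · intro i hi hij
    rw [Finset.mem_range] at hi
    rcases lt_or_gt_of_ne hij with hlt | hgt
    · rw [gridIndicator_of_le (hfj _ hlt.le), gridIndicator_of_le (hfj _ hlt), sub_zero, zero_mul]
    rcases lt_or_ge i k with hik | hik
    · rw [gridIndicator_of_lt (hfk _ hgt hik.le), gridIndicator_of_lt (hfk _ (by lia) hik),
        sub_self, zero_mul]
    · rw [gridIndicator_of_le (hek i hik hi.le), mul_zero]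

/-- The hypotheses say that the boundary of `{f < q}` meets the boundary of the grid inside
`{e < P}` exactly once, on the bottom side; hence it leaves `{e < P}` inside the grid. -/
theorem exists_crossing {D q P I m j k : ℕ} {f e : ℕ → ℕ → ℕ} (hf : IsGridLipschitz D I m f)
    (he : IsGridLipschitz D I m e) (hleft : ∀ t ≤ m, q ≤ f 0 t) (hright : ∀ t ≤ m, P ≤ e I t)
    (htop : ∀ i ≤ I, q ≤ f i m) (hjk : j < k) (hkI : k ≤ I) (hfj : ∀ i ≤ j, q ≤ f i 0)
    (hfk : ∀ i, j < i → i ≤ k → f i 0 < q) (hej : e j 0 < P)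
    (hek : ∀ i, k ≤ i → i ≤ I → P ≤ e i 0) :
    ∃ i ≤ I, ∃ t ≤ m, Nat.dist (f i t) q ≤ 2 * D ∧ Nat.dist (e i t) P ≤ 2 * D := by
  by_contra! hno
  have hrows := sum_range_eq_of_cells
    (h := fun i t =>
      (gridIndicator f q (i + 1) t - gridIndicator f q i t) * gridIndicator e P i t)
    (v := fun i t =>
      (gridIndicator f q i (t + 1) - gridIndicator f q i t) * gridIndicator e P i t)
    (fun i hi t ht => gridIndicator_cell hf he hi ht (hno i hi.le t ht.le))
    (fun t ht => by
      rw [gridIndicator_of_le (hleft _ ht), gridIndicator_of_le (hleft _ ht.le), sub_zero,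
        zero_mul])
    (fun t ht => by rw [gridIndicator_of_le (hright _ ht.le), mul_zero])
  rw [sum_gridIndicator_bottom hjk hkI hfj hfk hej hek, Finset.sum_eq_zero fun i hi => ?_] at hrows
  · exact zero_ne_one hrows
  · have hi := Finset.mem_range.1 hi
    rw [gridIndicator_of_le (htop _ hi), gridIndicator_of_le (htop _ hi.le), sub_zero, zero_mul]

theorem exists_triangle_dist_le {u v n t κ : ℕ} (huv : u ≤ v + n) (hvu : v ≤ u + n)
    (hn : n ≤ u + v) (ht : Nat.dist t u ≤ κ) :
    ∃ t', t' ≤ t + n ∧ t ≤ n + t' ∧ n ≤ t + t' ∧ Nat.dist t' v ≤ κ := by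
  simp only [Nat.dist] at ht ⊢
  exact ⟨max (max (t - n) (n - t)) (min (t + n) v), by lia⟩

namespace WordLength

variable {G : Type*} [Group G] {ℓ : WordLength G} {a : G → ℝ} {c : ℝ}

/-- Sweep the three vertices `γ i`, `z t`, `γ (i + Q)`, where `z` is a path that starts at `γ k` and
ends at a distance `q` from `γ`. -/
theorem IsGeodesic.exists_len_mul_eq {D q P Q m r : ℕ} {γ z : ℕ → G}
    (hγ : ℓ.IsGeodesic (q + r + P + r + Q) γ) (hD : ∀ x, ℓ x ≤ 1 → ℓ.symm x ≤ D)
    (hqQ : q ≤ Q) (hPQ : P ≤ Q) (hQ : Q < q + P) (hz0 : z 0 = γ (q + r))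
    (hzstep : ∀ t < m, ℓ.symm ((z t)⁻¹ * z (t + 1)) ≤ D)
    (hzr : ∀ t ≤ m, ℓ.symm ((γ (q + r))⁻¹ * z t) ≤ r)
    (hzm : ∀ i ≤ q + r + P + r, q ≤ ℓ ((γ i)⁻¹ * z m)) :
    ∃ x y, ℓ (x * y) = Q ∧ Nat.dist (ℓ x) q ≤ 2 * D ∧ Nat.dist (ℓ y) P ≤ 2 * D := by
  have hγstep : ∀ i < q + r + P + r + Q, ℓ.symm ((γ i)⁻¹ * γ (i + 1)) ≤ D := fun i hi =>
    hD _ (by rw [hγ i.le_succ hi]; lia)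
  obtain ⟨i, hi, t, -, hx, hy⟩ := exists_crossing (D := D) (q := q) (P := P) (j := r)
    (k := q + r) (f := fun i t => ℓ ((γ i)⁻¹ * z t)) (e := fun i t => ℓ ((z t)⁻¹ * γ (i + Q)))
    ⟨fun i hi t _ => (ℓ.dist_inv_mul_left_le _ _ _).trans (hγstep i (by lia)),
      fun i _ t ht => (ℓ.dist_inv_mul_right_le _ _ _).trans (hzstep t ht)⟩
    ⟨fun i hi t _ => (ℓ.dist_inv_mul_right_le _ _ _).trans
        (by simpa only [add_right_comm _ 1 Q] using hγstep (i + Q) (by lia)),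
      fun i _ t ht => (ℓ.dist_inv_mul_left_le _ _ _).trans (hzstep t ht)⟩
    (fun t ht => by
      have h := ℓ.dist_inv_mul_right_le (γ (q + r)) (z t) (γ 0)
      simp only [Nat.dist, hγ (q + r).zero_le (by lia)] at h
      have := hzr t ht
      lia)
    (fun t ht => by
      have h := ℓ.dist_inv_mul_left_le (γ (q + r)) (z t) (γ (q + r + P + r + Q))
      simp only [Nat.dist, hγ (show q + r ≤ q + r + P + r + Q by lia) le_rfl] at h
      have := hzr t ht
      lia)
    hzm (by lia) (by lia)
    (fun i hi => by rw [hz0, hγ (by lia) (by lia)]; lia)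
    (fun i hi hik => by rw [hz0, hγ hik (by lia)]; lia)
    (by rw [hz0, hγ (by lia) (by lia)]; lia)
    (fun i hki hi => by rw [hz0, hγ (by lia) (by lia)]; lia)
  refine ⟨_, _, ?_, hx, hy⟩
  rw [mul_assoc, mul_inv_cancel_left, hγ (by lia) (by lia), Nat.add_sub_cancel_left]

theorem exists_len_mul_eq_of_not_isLinelike (hL : ¬ ℓ.IsLinelike) {D q P Q : ℕ}
    (hD : ∀ x, ℓ x ≤ 1 → ℓ.symm x ≤ D) (hqQ : q ≤ Q) (hPQ : P ≤ Q) (hQ : Q < q + P) :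
    ∃ x y, ℓ (x * y) = Q ∧ Nat.dist (ℓ x) q ≤ 2 * D ∧ Nat.dist (ℓ y) P ≤ 2 * D := by
  simp only [IsLinelike, not_exists, not_forall] at hL
  obtain ⟨s, hs⟩ := hL q
  set k := q + D * s
  obtain ⟨γ, hγ⟩ := ℓ.exists_isGeodesic (k + P + D * s + Q)
  obtain ⟨g, hgs, hg⟩ : ∃ g, ℓ g ≤ s ∧
      ∀ i ≤ k + P + D * s + Q, q < ℓ ((γ i)⁻¹ * (γ k * g)) := by
    by_contra! h
    exact hs _ k γ ⟨by lia, hγ, h⟩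
  obtain ⟨p, hp0, hpg, hp⟩ := ℓ.exists_isGeodesic_of_len g
  have hpstep : ∀ t < ℓ g, ℓ.symm ((γ k * p t)⁻¹ * (γ k * p (t + 1))) ≤ D := fun t ht =>
    hD _ (by rw [mul_inv_rev, mul_assoc, inv_mul_cancel_left, hp t.le_succ ht]; lia)
  refine hγ.exists_len_mul_eq hD hqQ hPQ hQ (by rw [hp0, mul_one]) hpstep (fun t ht => ?_)
    (fun i hi => by rw [hpg]; exact (hg i (by lia)).le)
  have h := inv_mul_le_of_steps_le (γ := fun t => γ k * p t) ℓ.symm_one ℓ.symm_mul_le hpstep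
    t.zero_le ht
  simp only [hp0, mul_one, tsub_zero] at h
  exact h.trans (Nat.mul_le_mul_left _ (ht.trans hgs))

variable (ℓ a) in
/-- Up to an error `R`, the values of `a` at the lengths `p`, `q`, `r` are those of the sides of a
triangle in `G`. -/
def IsNearTriangle (R : ℝ) (p q r : ℕ) : Prop :=
  ∃ x y, |a x - ℓ.profile a p| ≤ R ∧ |a y - ℓ.profile a q| ≤ R ∧ |a (x * y) - ℓ.profile a r| ≤ R

namespace IsNearTriangle

variable {R : ℝ} {p q r : ℕ}

theorem swap (h : ℓ.IsNearTriangle a R p q r) (ha : ℓ.IsAlmostRadial a c) :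
    ℓ.IsNearTriangle a R q p r := by
  obtain ⟨x, y, hp, hq, hr⟩ := h
  exact ⟨y⁻¹, x⁻¹, by rwa [ha.inv], by rwa [ha.inv], by rwa [← mul_inv_rev, ha.inv]⟩

theorem rotate (h : ℓ.IsNearTriangle a R p q r) (ha : ℓ.IsAlmostRadial a c) :
    ℓ.IsNearTriangle a R p r q := by
  obtain ⟨x, y, hp, hq, hr⟩ := h
  exact ⟨x⁻¹, x * y, by rwa [ha.inv], hr, by rwa [inv_mul_cancel_left]⟩

theorem profile_le (h : ℓ.IsNearTriangle a R p q r) (ha : ℓ.IsAlmostRadial a c) :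
    ℓ.profile a r ≤ ℓ.profile a p + ℓ.profile a q + 3 * R := by
  obtain ⟨x, y, hp, hq, hr⟩ := h
  linarith [ha.mul_le x y, (abs_le.1 hp).2, (abs_le.1 hq).2, (abs_le.1 hr).1]

end IsNearTriangle

theorem IsAlmostRadial.exists_isNearTriangle (ha : ℓ.IsAlmostRadial a c) (hL : ¬ ℓ.IsLinelike)
    (hf : Tendsto (ℓ.profile a) atTop atTop) :
    ∃ R, ∀ p q r, p ≤ q → q ≤ r → r ≤ p + q → ℓ.IsNearTriangle a R p q r := by
  obtain ⟨D, hD⟩ := ha.exists_symm_le hf 1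
  refine ⟨c + (partialSups (ℓ.profile a) (2 * D) + 3 * c), fun p q r hpq hqr hr => ?_⟩
  have hclose : ∀ x n, Nat.dist (ℓ x) n ≤ 2 * D →
      |a x - ℓ.profile a n| ≤ c + (partialSups (ℓ.profile a) (2 * D) + 3 * c) := fun x n h =>
    (abs_sub_le _ (ℓ.profile a (ℓ x)) _).trans
      (add_le_add (ha.abs_sub_profile_le rfl) (ha.abs_profile_sub_profile_le h))
  have hself : ∀ n, Nat.dist n n ≤ 2 * D := fun n => by simp [Nat.dist_self]
  rcases hr.lt_or_eq with hr | rfl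
  · obtain ⟨x, y, hxy, hx, hy⟩ :=
      exists_len_mul_eq_of_not_isLinelike hL hD (hpq.trans hqr) hqr hr
    exact ⟨x, y, hclose x p hx, hclose y q hy, hclose _ r (hxy ▸ hself _)⟩
  · obtain ⟨z, hz⟩ := ℓ.surjective (p + q)
    obtain ⟨x, y, rfl, rfl, rfl⟩ := ℓ.exists_mul_eq hz
    exact ⟨x, y, hclose x _ (hself _), hclose y _ (hself _), hclose _ _ (hz ▸ hself _)⟩

theorem IsAlmostRadial.hasTriangles (ha : ℓ.IsAlmostRadial a c) (hL : ¬ ℓ.IsLinelike)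
    (hf : Tendsto (ℓ.profile a) atTop atTop) : ℓ.HasTriangles a := by
  obtain ⟨R, hR⟩ := ha.exists_isNearTriangle hL hf
  refine ⟨3 * R, fun p q r hr hp hq => IsNearTriangle.profile_le ?_ ha⟩
  rcases le_total p q with hpq | hqp <;> rcases le_total q r with hqr | hrq <;>
    rcases le_total p r with hpr | hrp
  · exact hR p q r hpq hqr hr
  · exact hR p q r hpq hqr hr
  · exact (hR p r q hpr hrq hq).rotate ha
  · exact ((hR r p q hrp hpq (by lia)).swap ha).rotate ha
  · exact (hR q p r hqp hpr (by lia)).swap ha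
  · exact ((hR q r p hqr hrp hp).rotate ha).swap ha
  · exact (((hR r q p hrq hqp (by lia)).rotate ha).swap ha).rotate ha
  · exact (((hR r q p hrq hqp (by lia)).rotate ha).swap ha).rotate ha

theorem HasTriangles.hasWordBound (ha : ℓ.IsAlmostRadial a c) (h : ℓ.HasTriangles a) :
    ℓ.HasWordBound a := by
  obtain ⟨H, h⟩ := h
  have hc := ha.const_nonneg
  have h0 := ha.profile_nonneg 0
  set C := ℓ.profile a 0 + |H| + 4 * c
  refine ⟨C, fun E => ⟨E.sup ℓ.symm, fun l => ?_⟩⟩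
  obtain ⟨t, ht, htl⟩ : ∃ t, ℓ.profile a t ≤
      (l.map ((E : Set G)ᶜ.indicator fun x => a x + C)).sum + ℓ.profile a 0 ∧
      Nat.dist t (ℓ.symm l.prod) ≤ E.sup ℓ.symm * l.length := by
    induction l with
    | nil => exact ⟨0, by simp [symm_one]⟩
    | cons x l ih =>
      obtain ⟨t, ht, htl⟩ := ih
      have hxl := ℓ.symm_mul_le x l.prod
      have hl := ℓ.symm_le_symm_mul_left x l.prod
      have hx := ℓ.symm_le_symm_mul_right x l.prod
      simp only [List.map_cons, List.sum_cons, List.prod_cons, List.length_cons, mul_add, mul_one]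
      by_cases hxE : x ∈ E
      · have hxE' : ℓ.symm x ≤ E.sup ℓ.symm := Finset.le_sup hxE
        refine ⟨t, by rwa [Set.indicator_of_notMem (by simpa), zero_add], ?_⟩
        simp only [Nat.dist] at htl ⊢
        lia
      · obtain ⟨t', h1, h2, h3, ht'⟩ :=
          exists_triangle_dist_le (v := ℓ.symm (x * l.prod)) (n := ℓ.symm x) (by lia)
            (by lia) (by lia) htl
        refine ⟨t', ?_, ht'.trans (Nat.le_add_right _ _)⟩
        rw [Set.indicator_of_mem (by simpa)]
        linarith [h t (ℓ.symm x) t' h1 h2 h3, le_abs_self H,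
          (abs_le.1 (ha.abs_sub_profile_symm_le x)).1]
  linarith [(abs_le.1 (ha.abs_profile_sub_profile_le htl)).1, abs_nonneg H,
    (abs_le.1 (ha.abs_sub_profile_symm_le l.prod)).2]

theorem IsAlmostRadial.hasWordBound (ha : ℓ.IsAlmostRadial a c) : ℓ.HasWordBound a := by
  by_cases hf : Tendsto (ℓ.profile a) atTop atTop
  · by_cases hL : ℓ.IsLinelike
    · exact (hL.embedsInLine ha hf).hasWordBound ha
    · exact (ha.hasTriangles hL hf).hasWordBound ha
  · simp only [tendsto_atTop, not_forall, not_eventually, not_le] at hf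
    obtain ⟨B, hB⟩ := hf
    exact (ha.embedsInLine_of_frequently (hB.mono fun _ h => h.le)).hasWordBound ha

end WordLength

/-! ### Word bounds for weights -/

theorem sInf_mem_pow_le_iff {G : Type*} [Group G] {V : Set G} (hone : (1 : G) ∈ V)
    (hgen : (⋃ n : ℕ, V ^ n) = Set.univ) {x : G} {n : ℕ} : sInf {k | x ∈ V ^ k} ≤ n ↔ x ∈ V ^ n :=
  ⟨fun h => Set.pow_right_monotone hone h <| Nat.sInf_mem <| Set.mem_iUnion.1 <|
    hgen ▸ Set.mem_univ x, fun h => Nat.sInf_le h⟩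

/-- The word length with respect to a generating set `V ∋ 1` whose powers increase strictly. -/
noncomputable def WordLength.ofGenerators {G : Type*} [Group G] (V : Set G) (hone : (1 : G) ∈ V)
    (hgen : (⋃ n : ℕ, V ^ n) = Set.univ) (hne : ∀ n, ¬ V ^ (n + 1) ⊆ V ^ n) : WordLength G :=
  have hle : ∀ x n, sInf {k | x ∈ V ^ k} ≤ n ↔ x ∈ V ^ n := fun _ _ =>
    sInf_mem_pow_le_iff hone hgen
  have hmul : ∀ x y, sInf {k | x * y ∈ V ^ k} ≤ sInf {k | x ∈ V ^ k} + sInf {k | y ∈ V ^ k} :=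
    fun x y => (hle _ _).2 <| pow_add V _ _ ▸
      Set.mul_mem_mul ((hle _ _).1 le_rfl) ((hle _ _).1 le_rfl)
  { toFun x := sInf {k | x ∈ V ^ k}
    eq_one' x hx := by simpa using (hle x 0).1 hx.le
    mul_le' := hmul
    exists_mul_eq' x m n hx := by
      have h := (hle x (m + n)).1 hx.le
      rw [pow_add] at h
      obtain ⟨y, hy, z, hz, rfl⟩ := Set.mem_mul.1 h
      have hyz := hmul y z
      rw [← hle] at hy hz
      exact ⟨y, z, rfl, by lia, by lia⟩
    surjective' n := by
      cases n with
      | zero => exact ⟨1, Nat.le_zero.1 ((hle 1 0).2 (by simp))⟩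
      | succ n =>
        obtain ⟨x, hx, hx'⟩ := Set.not_subset.1 (hne n)
        rw [← hle] at hx hx'
        exact ⟨x, by lia⟩ }

namespace SymmWeight

variable {G : Type*} [Group G] (ν : SymmWeight G) (V : Set G)

/-- Words are bounded by the product of the weights of their letters, where letters from a finite
set count for nothing and the others for a constant multiple of their weight, up to a
subexponential factor in the number of letters. The bound is stated for logarithms. -/
def HasSubexponentialWordBound : Prop :=
  ∃ C : ℝ, ∀ E : Finset G, ∃ b : ℕ → ℝ, Tendsto (fun n : ℕ => b n / n) atTop (𝓝 0) ∧
    ∀ l : List G, Real.log (ν l.prod) ≤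
      (l.map ((E : Set G)ᶜ.indicator fun x => Real.log (ν x) + C)).sum + b l.length

/-- The supremum of `ν` on `V ^ n` grows subexponentially. -/
def HasSubexponentialGrowth : Prop :=
  Tendsto (fun n : ℕ => (⨆ x ∈ V ^ n, ENNReal.ofReal (ν x)) ^ (1 / (n : ℝ))) atTop (𝓝 1)

/-- The logarithm of the supremum of `ν` on `V ^ n`, which has the junk value `0` when this
supremum is infinite. -/
noncomputable def logGrowth (n : ℕ) : ℝ := Real.log (⨆ x ∈ V ^ n, ENNReal.ofReal (ν x)).toReal

theorem log_nonneg (x : G) : 0 ≤ Real.log (ν x) := Real.log_nonneg (ν.one_le' x)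

theorem log_mul_le (x y : G) : Real.log (ν (x * y)) ≤ Real.log (ν x) + Real.log (ν y) := by
  rw [← Real.log_mul (ν.pos x).ne' (ν.pos y).ne']
  exact Real.log_le_log (ν.pos _) (ν.mul_le' x y)

variable {ν V}

theorem hasSubexponentialWordBound_of_log_le {M : ℝ} (hM : ∀ x, Real.log (ν x) ≤ M) :
    ν.HasSubexponentialWordBound := by
  refine ⟨0, fun E => ⟨fun _ => M, tendsto_const_div_atTop_nhds_zero_nat _, fun l => ?_⟩⟩
  have hsum : 0 ≤ (l.map ((E : Set G)ᶜ.indicator fun x => Real.log (ν x) + 0)).sum := by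
    refine List.sum_nonneg (List.forall_mem_map.2 fun x _ => ?_)
    exact Set.indicator_nonneg (fun x _ => by simpa using ν.log_nonneg x) x
  linarith [hM l.prod]

theorem le_mul_of_biSup_le_mul_biInf {s : Set G} {C : ℝ≥0}
    (h : (⨆ x ∈ s, ENNReal.ofReal (ν x)) ≤ (C : ℝ≥0∞) * ⨅ x ∈ s, ENNReal.ofReal (ν x))
    {x y : G} (hx : x ∈ s) (hy : y ∈ s) : ν x ≤ C * ν y := by
  have hxy : ENNReal.ofReal (ν x) ≤ C * ENNReal.ofReal (ν y) :=
    calc ENNReal.ofReal (ν x) ≤ ⨆ x ∈ s, ENNReal.ofReal (ν x) :=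
          le_biSup (fun x => ENNReal.ofReal (ν x)) hx
      _ ≤ C * ⨅ x ∈ s, ENNReal.ofReal (ν x) := h
      _ ≤ C * ENNReal.ofReal (ν y) := by gcongr; exact biInf_le _ hy
  rwa [← ENNReal.ofReal_coe_nnreal, ← ENNReal.ofReal_mul C.coe_nonneg,
    ENNReal.ofReal_le_ofReal_iff (mul_nonneg C.coe_nonneg (ν.nonneg y))] at hxy

theorem isAlmostRadial_log (hone : (1 : G) ∈ V) (hgen : (⋃ n : ℕ, V ^ n) = Set.univ)
    (hne : ∀ n, ¬ V ^ (n + 1) ⊆ V ^ n) {C : ℝ≥0}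
    (hC : ∀ n : ℕ, (⨆ x ∈ V ^ (n + 1) \ V ^ n, ENNReal.ofReal (ν x)) ≤
      (C : ℝ≥0∞) * ⨅ x ∈ V ^ (n + 1) \ V ^ n, ENNReal.ofReal (ν x)) :
    (WordLength.ofGenerators V hone hgen hne).IsAlmostRadial (fun x => Real.log (ν x))
      (Real.log (max C 1)) := by
  set ℓ := WordLength.ofGenerators V hone hgen hne
  have hsphere : ∀ x n, ℓ x = n + 1 → x ∈ V ^ (n + 1) \ V ^ n := fun x n hx =>
    ⟨(sInf_mem_pow_le_iff hone hgen).1 hx.le, fun h =>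
      (Nat.lt_succ_self n).not_ge (hx.ge.trans ((sInf_mem_pow_le_iff hone hgen).2 h))⟩
  have hle : ∀ ⦃x y⦄, ℓ x = ℓ y → Real.log (ν x) ≤ Real.log (max C 1) + Real.log (ν y) := by
    intro x y hxy
    rw [← Real.log_mul (by positivity) (ν.pos y).ne']
    refine Real.log_le_log (ν.pos x) ?_
    rcases hx : ℓ x with _ | n
    · rw [ℓ.eq_one hx, ℓ.eq_one (hxy.symm.trans hx)]
      exact le_mul_of_one_le_left (ν.nonneg 1) (le_max_right _ _)
    · exact (le_mul_of_biSup_le_mul_biInf (hC n) (hsphere x n hx)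
        (hsphere y n (hxy.symm.trans hx))).trans (by gcongr; exacts [ν.nonneg y, le_max_left _ _])
  exact ⟨ν.log_mul_le, fun x => by rw [ν.inv'], fun x y hxy =>
    abs_sub_le_iff.2 ⟨sub_le_iff_le_add.2 (hle hxy), sub_le_iff_le_add.2 (hle hxy.symm)⟩⟩

namespace HasSubexponentialGrowth

variable (hone : (1 : G) ∈ V) (hgrowth : ν.HasSubexponentialGrowth V)
include hone hgrowth

theorem biSup_ne_top (m : ℕ) : (⨆ x ∈ V ^ m, ENNReal.ofReal (ν x)) ≠ ∞ := by
  obtain ⟨n, hn, hmn⟩ := ((hgrowth.eventually_lt_const (u := ∞) ENNReal.one_lt_top).and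
    (eventually_ge_atTop (m + 1))).exists
  have hn0 : (0 : ℝ) < 1 / n := one_div_pos.2 (Nat.cast_pos.2 (Nat.zero_lt_of_lt hmn))
  exact ne_top_of_le_ne_top ((ENNReal.rpow_lt_top_iff_of_pos hn0).1 hn).ne
    (biSup_mono (Set.pow_right_monotone hone (by lia)))

theorem le_toReal_biSup {n : ℕ} {x : G} (hx : x ∈ V ^ n) :
    ν x ≤ (⨆ x ∈ V ^ n, ENNReal.ofReal (ν x)).toReal :=
  (ENNReal.ofReal_le_iff_le_toReal (hgrowth.biSup_ne_top hone n)).1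
    (le_biSup (fun x => ENNReal.ofReal (ν x)) hx)

theorem toReal_biSup_pos (n : ℕ) : 0 < (⨆ x ∈ V ^ n, ENNReal.ofReal (ν x)).toReal :=
  (ν.pos 1).trans_le (hgrowth.le_toReal_biSup hone (Set.one_mem_pow hone))

theorem log_le_logGrowth {n : ℕ} {x : G} (hx : x ∈ V ^ n) : Real.log (ν x) ≤ ν.logGrowth V n :=
  Real.log_le_log (ν.pos x) (hgrowth.le_toReal_biSup hone hx)

theorem tendsto_logGrowth_div :
    Tendsto (fun n : ℕ => ν.logGrowth V n / n) atTop (𝓝 0) := by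
  have h := ((ENNReal.tendsto_toReal ENNReal.one_ne_top).comp hgrowth).log (by simp)
  rw [ENNReal.toReal_one, Real.log_one] at h
  refine h.congr fun n => ?_
  rw [Function.comp_apply, ← ENNReal.toReal_rpow, Real.log_rpow (hgrowth.toReal_biSup_pos hone n),
    one_div_mul_eq_div, logGrowth]

theorem tendsto_logGrowth_mul_div (K : ℕ) :
    Tendsto (fun n : ℕ => ν.logGrowth V ((K + 1) * n) / n) atTop (𝓝 0) := by
  have h := ((hgrowth.tendsto_logGrowth_div hone).comp
    (tendsto_id.const_mul_atTop' (Nat.succ_pos K))).const_mul ((K : ℝ) + 1)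
  rw [mul_zero] at h
  refine h.congr fun n => ?_
  have hK : (K : ℝ) + 1 ≠ 0 := by positivity
  rw [Function.comp_apply, id, Nat.cast_mul, Nat.cast_succ]
  field_simp

end HasSubexponentialGrowth

theorem hasSubexponentialWordBound (hone : (1 : G) ∈ V) (hgen : (⋃ n : ℕ, V ^ n) = Set.univ)
    (hgrowth : ν.HasSubexponentialGrowth V)
    (hcomp : ∃ C : ℝ≥0, ∀ n : ℕ, (⨆ x ∈ V ^ (n + 1) \ V ^ n, ENNReal.ofReal (ν x)) ≤
      (C : ℝ≥0∞) * ⨅ x ∈ V ^ (n + 1) \ V ^ n, ENNReal.ofReal (ν x)) :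
    ν.HasSubexponentialWordBound := by
  by_cases hne : ∀ n, ¬ V ^ (n + 1) ⊆ V ^ n
  · obtain ⟨C₀, hC₀⟩ := hcomp
    set ℓ := WordLength.ofGenerators V hone hgen hne
    obtain ⟨C, hword⟩ := (isAlmostRadial_log hone hgen hne hC₀).hasWordBound
    refine ⟨C, fun E => ?_⟩
    obtain ⟨K, hK⟩ := hword E
    refine ⟨fun n => ν.logGrowth V ((K + 1) * n) + C, ?_, fun l => ?_⟩
    · simpa only [add_div, add_zero] using (hgrowth.tendsto_logGrowth_mul_div hone K).add
        (tendsto_const_div_atTop_nhds_zero_nat C)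
    · have hprofile : partialSups (ℓ.profile fun x => Real.log (ν x)) (K * l.length) ≤
          ν.logGrowth V ((K + 1) * l.length) := partialSups_le _ _ _ fun m hm =>
        hgrowth.log_le_logGrowth hone <| (sInf_mem_pow_le_iff hone hgen).1 <|
          (Function.surjInv_eq ℓ.surjective m).trans_le (hm.trans (by gcongr; lia))
      linarith [hK l]
  · simp only [not_forall, not_not] at hne
    obtain ⟨m, hm⟩ := hne
    have hstable : ∀ n, V ^ n ⊆ V ^ m := fun n => by
      induction n with
      | zero => exact Set.pow_right_monotone hone (Nat.zero_le m)
      | succ n ih =>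
        rw [pow_succ]
        exact (Set.mul_subset_mul_right ih).trans ((pow_succ V m).symm.subset.trans hm)
    refine hasSubexponentialWordBound_of_log_le fun x => hgrowth.log_le_logGrowth hone (n := m) ?_
    obtain ⟨n, hn⟩ := Set.mem_iUnion.1 (hgen ▸ Set.mem_univ x)
    exact hstable n hn

end SymmWeight

/-! ### Transfer of symmetry along a homomorphism that controls the spectrum -/

theorem norm_le_of_mul_pow_le {𝔸 : Type*} [NormedRing 𝔸] [NormedAlgebra ℂ 𝔸] [CompleteSpace 𝔸]
    [Nontrivial 𝔸] {x : 𝔸} {w : ℂ} {m M ρ : ℝ} (hm : 0 < m) (hρ : 0 ≤ ρ)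
    (hσ : ∀ t ∈ spectrum ℂ x, ‖t‖ ≤ ρ) (h : ∀ n : ℕ, m * ‖w‖ ^ n ≤ M * ‖x ^ n‖) : ‖w‖ ≤ ρ := by
  by_contra! hlt
  obtain ⟨r, hρr, hrw⟩ := exists_between hlt
  have hr : 0 < r := hρ.trans_lt hρr
  have hradius : spectralRadius ℂ x < ENNReal.ofReal r :=
    spectrum.spectralRadius_lt_of_forall_lt x fun t ht => by
      rw [← NNReal.coe_lt_coe, coe_nnnorm, Real.coe_toNNReal _ hr.le]
      exact (hσ t ht).trans_lt hρr
  have hroot := (spectrum.pow_norm_pow_one_div_tendsto_nhds_spectralRadius x).eventually_lt_const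
    hradius
  have hratio := (tendsto_pow_atTop_atTop_of_one_lt ((one_lt_div hr).2 hrw)).eventually_gt_atTop
    (|M| / m)
  obtain ⟨n, ⟨hxn, hwn⟩, hn⟩ := ((hroot.and hratio).and (eventually_gt_atTop 0)).exists
  have hpow : ‖x ^ n‖ ≤ r ^ n := by
    rw [ENNReal.ofReal_lt_ofReal_iff hr, one_div] at hxn
    simpa only [Real.rpow_inv_natCast_pow (norm_nonneg _) hn.ne'] using
      pow_le_pow_left₀ (by positivity) hxn.le n
  rw [div_pow, div_lt_div_iff₀ hm (by positivity)] at hwn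
  have hM : M * ‖x ^ n‖ ≤ |M| * r ^ n := by gcongr; exact le_abs_self M
  linarith [h n]

theorem re_nonneg_and_im_eq_zero_of_forall_norm_sub_le {z : ℂ} {R : ℝ} (hR : 0 ≤ R)
    (h : ∀ (c : ℂ) (ρ : ℝ), (∀ t ∈ Set.Icc 0 R, ‖(t : ℂ) - c‖ ≤ ρ) → ‖z - c‖ ≤ ρ) :
    0 ≤ z.re ∧ z.im = 0 := by
  constructor
  · have hdisk := h R R fun t ht => by
      rw [← Complex.ofReal_sub, Complex.norm_real, Real.norm_eq_abs, abs_le]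
      constructor <;> linarith [ht.1, ht.2]
    have hre := (abs_le.1 ((Complex.abs_re_le_norm (z - R)).trans hdisk)).1
    rw [Complex.sub_re, Complex.ofReal_re] at hre
    linarith
  · have hdisk : ∀ s : ℝ, z.re ^ 2 + (z.im - s) ^ 2 ≤ R ^ 2 + s ^ 2 := fun s => by
      have hs := h (s * Complex.I) (√(R ^ 2 + s ^ 2)) fun t ht => by
        rw [Complex.norm_eq_sqrt_sq_add_sq]
        refine Real.sqrt_le_sqrt ?_
        simpa using pow_le_pow_left₀ ht.1 ht.2 2
      rw [Complex.norm_eq_sqrt_sq_add_sq, Real.sqrt_le_sqrt_iff (by positivity)] at hs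
      simpa using hs
    by_contra hne
    have hs := hdisk ((R ^ 2 + 1) * (-z.im⁻¹))
    have hinv : z.im * z.im⁻¹ = 1 := mul_inv_cancel₀ hne
    nlinarith [sq_nonneg z.re, sq_nonneg z.im]

theorem mul_sub_pow_mem_spectrum {𝕜 A : Type*} [Field 𝕜] [Ring A] [Algebra 𝕜 A] {a : A} {z : 𝕜}
    (hz : z ∈ spectrum 𝕜 a) (c : 𝕜) (n : ℕ) :
    z * (z - c) ^ n ∈ spectrum 𝕜 (a * (a - algebraMap 𝕜 A c) ^ n) := by
  have h := spectrum.subset_polynomial_aeval a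
    (Polynomial.X * (Polynomial.X - Polynomial.C c) ^ n) ⟨z, hz, rfl⟩
  simpa only [Polynomial.eval_mul, Polynomial.eval_X, Polynomial.eval_pow, Polynomial.eval_sub,
    Polynomial.eval_C, map_mul, Polynomial.aeval_X, map_pow, map_sub, Polynomial.aeval_C] using h

theorem spectrum_toLp_unitization {B : Type*} [NonUnitalNormedRing B] [NormedSpace ℂ B]
    [IsScalarTower ℂ B B] [SMulCommClass ℂ B B] (b : Unitization ℂ B) :
    spectrum ℂ (WithLp.toLp 1 b) = spectrum ℂ b :=
  (AlgEquiv.spectrum_eq (WithLp.unitizationAlgEquiv (𝕜 := ℂ) (A := B) ℂ) (WithLp.toLp 1 b)).symm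

section

variable {B B₁ : Type*} [NonUnitalRing B] [Module ℂ B] [IsScalarTower ℂ B B] [SMulCommClass ℂ B B]
  [NonUnitalNormedRing B₁] [NormedSpace ℂ B₁] [IsScalarTower ℂ B₁ B₁] [SMulCommClass ℂ B₁ B₁]

/-- The extension of a homomorphism to the unitizations, the target carrying the norm
`‖(z, b)‖ = ‖z‖ + ‖b‖`. -/
noncomputable def unitizationMap (Φ : B →ₙₐ[ℂ] B₁) :
    Unitization ℂ B →ₐ[ℂ] WithLp 1 (Unitization ℂ B₁) :=
  (WithLp.unitizationAlgEquiv (𝕜 := ℂ) (A := B₁) ℂ).symm.toAlgHom.comp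
    (Unitization.lift ((Unitization.inrNonUnitalAlgHom ℂ B₁).comp Φ))

theorem unitizationMap_inr (Φ : B →ₙₐ[ℂ] B₁) (k : B) :
    unitizationMap Φ k = WithLp.toLp 1 (Φ k : Unitization ℂ B₁) :=
  congrArg (WithLp.toLp 1) (by simp)

theorem norm_le_norm_unitizationMap {Φ : B →ₙₐ[ℂ] B₁}
    (hΦ : ∀ k, ∀ z ∈ quasispectrum ℂ k, ‖z‖ ≤ ‖Φ k‖) {x : Unitization ℂ B} (hx : x.fst = 0)
    {z : ℂ} (hz : z ∈ spectrum ℂ x) : ‖z‖ ≤ ‖unitizationMap Φ x‖ := by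
  obtain ⟨k, rfl⟩ : ∃ k : B, (k : Unitization ℂ B) = x := ⟨x.snd, Unitization.ext hx.symm rfl⟩
  rw [unitizationMap_inr, WithLp.unitization_norm_inr]
  exact hΦ k z ((Unitization.quasispectrum_eq_spectrum_inr ℂ k).symm ▸ hz)

/-- The idea is to compare the spectra of the elements `h (h - c) ^ n` with their images and to take
`n`-th roots; the factor `h` keeps these elements in `B`. -/
theorem norm_sub_le_of_mem_quasispectrum [CompleteSpace B₁] {Φ : B →ₙₐ[ℂ] B₁}
    (hΦ : ∀ k, ∀ z ∈ quasispectrum ℂ k, ‖z‖ ≤ ‖Φ k‖) {h : B} {z c : ℂ} {ρ : ℝ}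
    (hz : z ∈ quasispectrum ℂ h) (hc : ∀ t ∈ quasispectrum ℂ (Φ h), ‖t - c‖ ≤ ρ) :
    ‖z - c‖ ≤ ρ := by
  have hzero := hc 0 (quasispectrum.zero_mem ℂ _)
  rcases eq_or_ne z 0 with rfl | hz0
  · exact hzero
  have : Nontrivial (WithLp 1 (Unitization ℂ B₁)) :=
    (WithLp.equiv 1 (Unitization ℂ B₁)).nontrivial
  refine norm_le_of_mul_pow_le (x := unitizationMap Φ h - algebraMap ℂ _ c)
    (M := ‖unitizationMap Φ h‖) (norm_pos_iff.2 hz0) ((norm_nonneg _).trans hzero)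
    (fun t ht => ?_) fun n => ?_
  · rw [← spectrum.sub_singleton_eq, Set.sub_singleton, unitizationMap_inr,
      spectrum_toLp_unitization, ← Unitization.quasispectrum_eq_spectrum_inr] at ht
    obtain ⟨s, hs, rfl⟩ := ht
    exact hc s hs
  · rw [Unitization.quasispectrum_eq_spectrum_inr] at hz
    have hfst : ((h : Unitization ℂ B) *
        ((h : Unitization ℂ B) - algebraMap ℂ _ c) ^ n).fst = 0 := by
      rw [Unitization.fst_mul, Unitization.fst_inr, zero_mul]
    have hbound := norm_le_norm_unitizationMap hΦ hfst (mul_sub_pow_mem_spectrum hz c n)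
    rw [map_mul, map_pow, map_sub, AlgHom.commutes, norm_mul, norm_pow] at hbound
    exact hbound.trans (norm_mul_le _ _)

end

theorem IsSymmetricBanachStarAlgebra.of_hom {B B₁ : Type*}
    [NonUnitalNormedRing B] [StarRing B] [NormedStarGroup B] [NormedSpace ℂ B]
    [IsScalarTower ℂ B B] [SMulCommClass ℂ B B] [StarModule ℂ B] [CompleteSpace B]
    [NonUnitalNormedRing B₁] [StarRing B₁] [NormedStarGroup B₁] [NormedSpace ℂ B₁]
    [IsScalarTower ℂ B₁ B₁] [SMulCommClass ℂ B₁ B₁] [StarModule ℂ B₁] [CompleteSpace B₁]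
    (hB₁ : IsSymmetricBanachStarAlgebra B₁) (Φ : B →⋆ₙₐ[ℂ] B₁)
    (hΦ : ∀ k, ∀ z ∈ quasispectrum ℂ k, ‖z‖ ≤ ‖Φ k‖) : IsSymmetricBanachStarAlgebra B := by
  intro b z hz
  obtain ⟨R, hR⟩ := (quasispectrum.isCompact (𝕜 := ℂ) (Φ (star b * b))).isBounded.exists_norm_le
  refine re_nonneg_and_im_eq_zero_of_forall_norm_sub_le
    ((norm_nonneg _).trans (hR 0 (quasispectrum.zero_mem ℂ _))) fun c ρ hc =>
      norm_sub_le_of_mem_quasispectrum (Φ := (Φ : B →ₙₐ[ℂ] B₁)) hΦ hz fun t ht => ?_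
  have htR := hR t ht
  change t ∈ quasispectrum ℂ (Φ (star b * b)) at ht
  rw [map_mul, map_star] at ht
  obtain ⟨hre, him⟩ := hB₁ (Φ b) t ht
  rw [show t = (t.re : ℂ) from Complex.ext rfl him]
  exact hc _ ⟨hre, (Complex.re_le_norm t).trans htR⟩

/-! ### The spectral radius in a weighted crossed product -/

theorem norm_le_norm_of_mem_quasispectrum {B : Type*} [NonUnitalNormedRing B] [NormedSpace ℂ B]
    [IsScalarTower ℂ B B] [SMulCommClass ℂ B B] [CompleteSpace B] {b : B} {z : ℂ}
    (hz : z ∈ quasispectrum ℂ b) : ‖z‖ ≤ ‖b‖ := by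
  rw [Unitization.quasispectrum_eq_spectrum_inr, ← spectrum_toLp_unitization] at hz
  have hone : ‖(1 : WithLp 1 (Unitization ℂ B))‖ = 1 := by
    rw [WithLp.unitization_norm_def]
    change ‖(1 : Unitization ℂ B).fst‖ + ‖(1 : Unitization ℂ B).snd‖ = 1
    rw [Unitization.fst_one, Unitization.snd_one, norm_one, norm_zero, add_zero]
  simpa only [hone, mul_one, WithLp.unitization_norm_inr] using
    spectrum.norm_le_norm_mul_of_mem hz

theorem pow_succ_mem_quasispectrum_iterate {B : Type*} [NonUnitalRing B] [Module ℂ B]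
    [IsScalarTower ℂ B B] [SMulCommClass ℂ B B] {k : B} {z : ℂ} (hz : z ∈ quasispectrum ℂ k)
    (n : ℕ) : z ^ (n + 1) ∈ quasispectrum ℂ ((· * k)^[n] k) := by
  have hpow : (((· * k)^[n] k : B) : Unitization ℂ B) = (k : Unitization ℂ B) ^ (n + 1) := by
    induction n with
    | zero => rw [Function.iterate_zero_apply, zero_add, pow_one]
    | succ n ih => rw [Function.iterate_succ_apply', Unitization.inr_mul, ih, ← pow_succ]
  rw [Unitization.quasispectrum_eq_spectrum_inr] at hz ⊢
  exact hpow ▸ spectrum.pow_mem_pow _ (n + 1) hz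

theorem le_of_forall_pow_le_exp_mul_pow {r s : ℝ} (hs : 0 ≤ s) {b : ℕ → ℝ}
    (hb : Tendsto (fun n : ℕ => b n / n) atTop (𝓝 0))
    (h : ∀ n : ℕ, r ^ (n + 1) ≤ Real.exp (b (n + 1)) * s ^ (n + 1)) : r ≤ s := by
  have hlim : Tendsto (fun n : ℕ => Real.exp (b (n + 1) / (n + 1 : ℕ)) * s) atTop (𝓝 s) := by
    simpa only [Function.comp_def, Real.exp_zero, one_mul] using
      ((Real.continuous_exp.tendsto 0).comp ((tendsto_add_atTop_iff_nat 1).2 hb)).mul_const s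
  refine ge_of_tendsto' hlim fun n => le_of_pow_le_pow_left₀ n.succ_ne_zero (by positivity) ?_
  rw [mul_pow, ← Real.exp_nat_mul, Nat.succ_eq_add_one, mul_div_cancel₀ _ (by positivity)]
  exact h n

theorem ofReal_exp_sum_map {ι : Type*} (u : ι → ℝ) (l : List ι) :
    ENNReal.ofReal (Real.exp (l.map u).sum) =
      (l.map fun x => ENNReal.ofReal (Real.exp (u x))).prod := by
  induction l with
  | nil => simp
  | cons x l ih =>
    rw [List.map_cons, List.sum_cons, Real.exp_add, ENNReal.ofReal_mul (Real.exp_pos _).le, ih,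
      List.map_cons, List.prod_cons]

namespace TwistedCrossedProduct

variable {G A : Type*} [Group G] [NonUnitalCStarAlgebra A]
variable {S : TwistedCStarSystem G A} {ν : SymmWeight G}

theorem enorm_mul_apply_le (f g : TwistedCrossedProduct S ν) (x : G) :
    ‖(f * g) x‖ₑ ≤ ∑' y, ‖f y‖ₑ * ‖g (y⁻¹ * x)‖ₑ := by
  rw [mul_apply]
  refine enorm_tsum_le_tsum_enorm.trans (ENNReal.tsum_le_tsum fun y => ?_)
  rw [← ofReal_norm, ← ofReal_norm, ← ofReal_norm, ← ENNReal.ofReal_mul (norm_nonneg _)]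
  exact ENNReal.ofReal_le_ofReal (norm_convTerm_le _ _ _ _)

theorem tsum_mul_enorm_mul_le (v : G → ℝ≥0∞) (f g : TwistedCrossedProduct S ν) :
    ∑' x, v x * ‖(f * g) x‖ₑ ≤ ∑' z, (∑' y, v (y * z) * ‖f y‖ₑ) * ‖g z‖ₑ :=
  calc ∑' x, v x * ‖(f * g) x‖ₑ
      ≤ ∑' x, ∑' y, v x * (‖f y‖ₑ * ‖g (y⁻¹ * x)‖ₑ) := by
        simp_rw [ENNReal.tsum_mul_left]
        gcongr
        exact enorm_mul_apply_le f g _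
    _ = ∑' y, ∑' z, v (y * z) * ‖f y‖ₑ * ‖g z‖ₑ := by
        rw [ENNReal.tsum_comm]
        refine tsum_congr fun y => ?_
        rw [← (Equiv.mulLeft y).tsum_eq]
        simp only [Equiv.coe_mulLeft, inv_mul_cancel_left, mul_assoc]
    _ = ∑' z, (∑' y, v (y * z) * ‖f y‖ₑ) * ‖g z‖ₑ := by
        rw [ENNReal.tsum_comm]
        simp_rw [ENNReal.tsum_mul_right]

theorem tsum_mul_enorm_iterate_mul_le (k : TwistedCrossedProduct S ν) {w : G → ℝ≥0∞} (n : ℕ)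
    {v : G → ℝ≥0∞} {c : ℝ≥0∞}
    (h : ∀ l : List G, l.length = n + 1 → v l.prod ≤ c * (l.map w).prod) :
    ∑' x, v x * ‖(· * k)^[n] k x‖ₑ ≤ c * (∑' x, w x * ‖k x‖ₑ) ^ (n + 1) := by
  induction n generalizing v c with
  | zero =>
    rw [zero_add, pow_one, ← ENNReal.tsum_mul_left]
    refine ENNReal.tsum_le_tsum fun x => ?_
    rw [← mul_assoc, Function.iterate_zero_apply]
    gcongr
    simpa using h [x] rfl
  | succ n ih =>
    rw [Function.iterate_succ_apply']
    refine (tsum_mul_enorm_mul_le v _ k).trans ?_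
    calc ∑' z, (∑' y, v (y * z) * ‖(· * k)^[n] k y‖ₑ) * ‖k z‖ₑ
        ≤ ∑' z, c * w z * (∑' x, w x * ‖k x‖ₑ) ^ (n + 1) * ‖k z‖ₑ := by
          gcongr with z
          refine ih fun l hl => ?_
          simpa [mul_assoc, mul_comm (w z)] using h (l ++ [z]) (by simp [hl])
      _ = c * (∑' x, w x * ‖k x‖ₑ) ^ (n + 1 + 1) := by
          rw [pow_succ _ (n + 1), ← mul_assoc, ← ENNReal.tsum_mul_left]
          exact tsum_congr fun z => by ring

theorem ofReal_norm_eq_tsum (k : TwistedCrossedProduct S ν) :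
    ENNReal.ofReal ‖k‖ = ∑' x, ENNReal.ofReal (ν x) * ‖k x‖ₑ := by
  rw [norm_def, ENNReal.ofReal_tsum_of_nonneg
    (fun x => mul_nonneg (ν.nonneg x) (norm_nonneg _)) k.summable_weight]
  exact tsum_congr fun x => by rw [ENNReal.ofReal_mul (ν.nonneg x), ofReal_norm]

theorem norm_pow_le_of_log_prod_le {k : TwistedCrossedProduct S ν} {z : ℂ}
    (hz : z ∈ quasispectrum ℂ k) {u : G → ℝ} (hu : Summable fun x => Real.exp (u x) * ‖k x‖)
    {n : ℕ} {b : ℝ}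
    (h : ∀ l : List G, l.length = n + 1 → Real.log (ν l.prod) ≤ (l.map u).sum + b) :
    ‖z‖ ^ (n + 1) ≤ Real.exp b * (∑' x, Real.exp (u x) * ‖k x‖) ^ (n + 1) := by
  have hexp : ∀ x, 0 ≤ Real.exp (u x) * ‖k x‖ := fun x => by positivity
  have hsum : ENNReal.ofReal (∑' x, Real.exp (u x) * ‖k x‖) =
      ∑' x, ENNReal.ofReal (Real.exp (u x)) * ‖k x‖ₑ := by
    rw [ENNReal.ofReal_tsum_of_nonneg hexp hu]
    exact tsum_congr fun x => by rw [ENNReal.ofReal_mul (Real.exp_pos _).le, ofReal_norm]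
  have hbase : 0 ≤ ∑' x, Real.exp (u x) * ‖k x‖ := tsum_nonneg hexp
  have hspectrum := norm_le_norm_of_mem_quasispectrum (pow_succ_mem_quasispectrum_iterate hz n)
  rw [norm_pow] at hspectrum
  refine hspectrum.trans ?_
  rw [← ENNReal.ofReal_le_ofReal_iff (by positivity), ENNReal.ofReal_mul (Real.exp_pos _).le,
    ENNReal.ofReal_pow hbase, hsum, ofReal_norm_eq_tsum]
  refine tsum_mul_enorm_iterate_mul_le k n fun l hl => ?_
  rw [← ofReal_exp_sum_map, ← ENNReal.ofReal_mul (Real.exp_pos _).le, ← Real.exp_add, add_comm]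
  exact ENNReal.ofReal_le_ofReal ((Real.log_le_iff_le_exp (ν.pos _)).1 (h l hl))

theorem norm_le_tsum_exp_mul_norm_of_mem_quasispectrum {k : TwistedCrossedProduct S ν} {z : ℂ}
    (hz : z ∈ quasispectrum ℂ k) {u : G → ℝ} (hu : Summable fun x => Real.exp (u x) * ‖k x‖)
    {b : ℕ → ℝ} (hb : Tendsto (fun n : ℕ => b n / n) atTop (𝓝 0))
    (h : ∀ l : List G, Real.log (ν l.prod) ≤ (l.map u).sum + b l.length) :
    ‖z‖ ≤ ∑' x, Real.exp (u x) * ‖k x‖ :=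
  le_of_forall_pow_le_exp_mul_pow (tsum_nonneg fun _ => by positivity) hb fun _ =>
    norm_pow_le_of_log_prod_le hz hu fun l hl => hl ▸ h l

theorem norm_le_tsum_norm_of_mem_quasispectrum (hν : ν.HasSubexponentialWordBound)
    {k : TwistedCrossedProduct S ν} {z : ℂ} (hz : z ∈ quasispectrum ℂ k) :
    ‖z‖ ≤ ∑' x, ‖k x‖ := by
  classical
  obtain ⟨C, hν⟩ := hν
  have hfinite : ∀ E : Finset G, ‖z‖ ≤
      ∑' x, ‖k x‖ + Real.exp C * ∑' x : {x // x ∉ E}, ν x * ‖k x‖ := fun E => by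
    obtain ⟨b, hb, hword⟩ := hν E
    set u : G → ℝ := (E : Set G)ᶜ.indicator fun x => Real.log (ν x) + C
    have htail : HasSum ((E : Set G)ᶜ.indicator fun x => ν x * ‖k x‖)
        (∑' x : {x // x ∉ E}, ν x * ‖k x‖) :=
      hasSum_subtype_iff_indicator.1 (k.summable_weight.subtype _).hasSum
    have hsum := k.summable_norm.hasSum.add (htail.mul_left (Real.exp C))
    have hle : ∀ x, Real.exp (u x) * ‖k x‖ ≤
        ‖k x‖ + Real.exp C * (E : Set G)ᶜ.indicator (fun x => ν x * ‖k x‖) x := fun x => by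
      by_cases hx : x ∈ E
      · simp [u, hx]
      · have hu : u x = Real.log (ν x) + C := Set.indicator_of_mem (by simpa using hx) _
        rw [Set.indicator_of_mem (by simpa using hx), hu, Real.exp_add, Real.exp_log (ν.pos x)]
        linarith [norm_nonneg (k x)]
    have hu : Summable fun x => Real.exp (u x) * ‖k x‖ :=
      hsum.summable.of_nonneg_of_le (fun x => by positivity) hle
    exact (norm_le_tsum_exp_mul_norm_of_mem_quasispectrum hz hu hb hword).trans
      (hasSum_le hle hu.hasSum hsum)
  have hlim := ((tendsto_tsum_compl_atTop_zero fun x => ν x * ‖k x‖).const_mul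
    (Real.exp C)).const_add (∑' x, ‖k x‖)
  rw [mul_zero, add_zero] at hlim
  exact ge_of_tendsto' hlim hfinite

end TwistedCrossedProduct

/-! ### States attaining the norm of a positive element -/

section

open scoped ComplexOrder

theorem exists_positiveLinearMap_eq_ofReal {A : Type*} [NonUnitalRing A] [StarRing A] [Module ℂ A]
    [StarModule ℂ A] [PartialOrder A] [StarOrderedRing A] (f : A →ₗ[ℝ] ℝ)
    (hf : ∀ x, 0 ≤ x → 0 ≤ f x) : ∃ φ : A →ₚ[ℂ] ℂ, ∀ x, IsSelfAdjoint x → φ x = f x := by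
  let g : A →ₗ[ℝ] ℝ := f ∘ₗ (selfAdjoint.submodule ℝ A).subtype ∘ₗ realPart
  let φ : A →ₗ[ℂ] ℂ := Module.Dual.extendRCLike g
  have hφ : ∀ x, IsSelfAdjoint x → φ x = f x := fun x hx => by
    have hre : g x = f x := by
      change f (realPart x : A) = f x
      rw [hx.coe_realPart]
    have him : g (Complex.I • x) = 0 := by
      change f (realPart (Complex.I • x) : A) = 0
      rw [realPart_I_smul, hx.imaginaryPart, neg_zero, ZeroMemClass.coe_zero, map_zero]
    rw [Module.Dual.extendRCLike_apply (𝕜 := ℂ) g x, hre]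
    simp [him]
  refine ⟨PositiveLinearMap.mk₀ φ fun x hx => ?_, hφ⟩
  rw [hφ x (IsSelfAdjoint.of_nonneg hx)]
  exact_mod_cast hf x hx

variable {A : Type*} [CStarAlgebra A] [PartialOrder A] [StarOrderedRing A]

theorem norm_one_add_of_nonneg [Nontrivial A] {h : A} (hh : 0 ≤ h) : ‖1 + h‖ = 1 + ‖h‖ := by
  refine le_antisymm ((norm_add_le _ _).trans_eq (by rw [norm_one])) ?_
  have hmem := (spectrum.add_mem_add_iff (s := (1 : ℝ))).2
    (CStarAlgebra.norm_mem_spectrum_of_nonneg hh)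
  rw [map_one] at hmem
  rw [add_comm 1 ‖h‖]
  exact (le_abs_self _).trans (spectrum.norm_le_norm_of_mem hmem)

theorem apply_nonneg_of_forall_apply_le_norm {f : A →ₗ[ℝ] ℝ} (hone : f 1 = 1)
    (hf : ∀ x, f x ≤ ‖x‖) {x : A} (hx : 0 ≤ x) : 0 ≤ f x := by
  have hsub : 0 ≤ algebraMap ℝ A ‖x‖ - x :=
    sub_nonneg.2 (IsSelfAdjoint.of_nonneg hx).le_algebraMap_norm_self
  have hnorm : ‖algebraMap ℝ A ‖x‖ - x‖ ≤ ‖x‖ :=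
    (CStarAlgebra.norm_le_iff_le_algebraMap _ (norm_nonneg x) hsub).2 (sub_le_self _ hx)
  have hle := (hf _).trans hnorm
  rw [map_sub, Algebra.algebraMap_eq_smul_one, map_smul, hone, smul_eq_mul, mul_one] at hle
  linarith

variable [Nontrivial A]

theorem exists_state_apply_eq_norm {h : A} (hh : 0 ≤ h) :
    ∃ φ : A →ₚ[ℂ] ℂ, φ 1 = 1 ∧ φ h = ‖h‖ := by
  obtain ⟨f, hf, hfh⟩ := exists_dual_vector' ℝ (1 + h)
  have hle : ∀ x, f x ≤ ‖x‖ := fun x =>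
    (le_abs_self _).trans ((f.le_opNorm x).trans_eq (by rw [hf, one_mul]))
  have hsum : f 1 + f h = 1 + ‖h‖ := by
    rw [← map_add, hfh, norm_one_add_of_nonneg hh, RCLike.ofReal_real_eq_id, id]
  have hle_one : f 1 ≤ 1 := (hle 1).trans_eq norm_one
  have hone : f 1 = 1 := by linarith [hle h]
  obtain ⟨φ, hφ⟩ := exists_positiveLinearMap_eq_ofReal (f : A →ₗ[ℝ] ℝ)
    fun x => apply_nonneg_of_forall_apply_le_norm hone hle
  refine ⟨φ, ?_, ?_⟩
  · simp [hφ 1 (IsSelfAdjoint.one A), hone]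
  · rw [hφ h (IsSelfAdjoint.of_nonneg hh)]
    exact congrArg _ (by simpa [hone] using hsum)

theorem exists_gns_norm_apply_eq (a : A) :
    ∃ (φ : A →ₚ[ℂ] ℂ) (v : φ.GNS), ‖v‖ = 1 ∧ ‖φ.gnsNonUnitalStarAlgHom a v‖ = ‖a‖ := by
  obtain ⟨φ, hone, ha⟩ := exists_state_apply_eq_norm (star_mul_self_nonneg a)
  refine ⟨φ, ((φ.toPreGNS 1 : φ.PreGNS) : φ.GNS), ?_, ?_⟩
  · rw [UniformSpace.Completion.norm_coe, ← sq_eq_sq₀ (norm_nonneg _) zero_le_one,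
      ← Complex.ofReal_inj, Complex.ofReal_pow, φ.preGNS_norm_sq]
    simp [hone]
  · rw [φ.gnsNonUnitalStarAlgHom_apply_coe, UniformSpace.Completion.norm_coe,
      ← sq_eq_sq₀ (norm_nonneg _) (norm_nonneg _), ← Complex.ofReal_inj, Complex.ofReal_pow,
      φ.preGNS_norm_sq, sq, ← CStarRing.norm_star_mul_self, ← ha]
    simp

end

/-! ### The regular representation of a twisted system -/

/-- Reindexing of `ℓᵖ` along a bijection, for finite `p`. -/
noncomputable def lpReindex {α β : Type*} (𝕜 E : Type*) [NormedField 𝕜] [NormedAddCommGroup E]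
    [NormedSpace 𝕜 E] {p : ℝ≥0∞} [Fact (1 ≤ p)] (hp : 0 < p.toReal) (e : α ≃ β) :
    lp (fun _ : β => E) p →ₗᵢ[𝕜] lp (fun _ : α => E) p where
  toFun ξ := ⟨fun a => ξ (e a), (memℓp_gen_iff hp).2 <|
    e.summable_iff.2 ((memℓp_gen_iff hp).1 (lp.memℓp ξ))⟩
  map_add' _ _ := rfl
  map_smul' _ _ := rfl
  norm_map' ξ := by
    rw [lp.norm_eq_tsum_rpow hp, lp.norm_eq_tsum_rpow hp]
    exact congrArg (· ^ (1 / p.toReal)) (e.tsum_eq fun b => ‖ξ b‖ ^ p.toReal)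

namespace TwistedCStarSystem

open MultiplierFacts

variable {G A : Type*} [Group G] [NonUnitalCStarAlgebra A] (S : TwistedCStarSystem G A)

/-- The map `a ↦ α_s(a) ω(s, x)`, which is how the regular representation moves a coefficient at
`x` to the point `s`. -/
noncomputable def twist (s x : G) : A →ₗ[ℂ] A where
  toFun a := (S.ω s x : 𝓜(ℂ, A)).snd (S.α s a)
  map_add' a b := by simp
  map_smul' c a := by simp

theorem twist_apply (s x : G) (a : A) :
    S.twist s x a = (S.ω s x : 𝓜(ℂ, A)).snd (S.α s a) := rfl

theorem norm_twist_le (s x : G) (a : A) : ‖S.twist s x a‖ ≤ ‖a‖ :=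
  (norm_snd_le _ _).trans_eq (norm_aut _ _)

theorem twist_one (x : G) (a : A) : S.twist 1 x a = a := by
  rw [twist_apply, S.ω_one_left, TwistedCrossedProduct.α_one]
  simp

theorem twist_mul (s x z : G) (a b : A) : S.twist s x a * S.twist (s * x) z b =
    S.twist s (x * z) ((S.ω x z : 𝓜(ℂ, A)).snd (a * S.α x b)) := by
  apply coe_inj
  have hα := S.α_comp s x b
  have hc := S.cocycle s x z
  simp only [twist_apply, coe_snd_apply, coe_mul, ← extend_coe (S.α s), extend_mul]
  simp only [extend_coe, mul_assoc] at hα ⊢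
  rw [← hc, hα]
  simp only [mul_assoc]
  rw [← mul_assoc (star (S.ω s x : 𝓜(ℂ, A))), TwistedCrossedProduct.star_mul_ω, one_mul]

theorem star_twist (t x : G) (a : A) : star (S.twist (t * x) x⁻¹ a) =
    S.twist t x ((star (S.ω x x⁻¹ : 𝓜(ℂ, A))).fst (star (S.α x a))) := by
  apply coe_inj
  have hα := S.α_comp t x (star a)
  have hc := S.cocycle t x x⁻¹
  rw [mul_inv_cancel, S.ω_one_right, OneMemClass.coe_one, mul_one] at hc
  simp only [twist_apply, coe_snd_apply, coe_fst_apply, coe_star,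
    ← extend_coe (S.α t), extend_mul, extend_star, ← map_star]
  simp only [extend_coe, ← hc, hα]
  simp only [star_mul, mul_assoc, TwistedCrossedProduct.star_mul_ω, mul_one]
  rw [← mul_assoc (star (S.ω t x : 𝓜(ℂ, A))), TwistedCrossedProduct.star_mul_ω, one_mul,
    map_star, coe_star]

section Representation

variable {H : Type*} [NormedAddCommGroup H] [InnerProductSpace ℂ H] [CompleteSpace H]
  (π : A →⋆ₙₐ[ℂ] (H →L[ℂ] H))

theorem norm_representation_twist_le (s x : G) (a : A) : ‖π (S.twist s x a)‖ ≤ ‖a‖ :=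
  (NonUnitalStarAlgHom.norm_apply_le π _).trans (S.norm_twist_le s x a)

/-- The image of the elementary function `a δ_x` under the regular representation induced from `π`:
the operator `(T ξ)(s) = π(α_s(a) ω(s, x)) ξ(s x)` on `ℓ²(G; H)`. -/
noncomputable def regularOp (x : G) (a : A) :
    lp (fun _ : G => H) 2 →L[ℂ] lp (fun _ : G => H) 2 :=
  (lp.mapCLM 2 (fun s => π (S.twist s x a)) (norm_nonneg a)
    fun s => S.norm_representation_twist_le π s x a).comp
    (lpReindex ℂ H (by norm_num) (Equiv.mulRight x)).toContinuousLinearMap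

theorem regularOp_apply (x : G) (a : A) (ξ : lp (fun _ : G => H) 2) (s : G) :
    S.regularOp π x a ξ s = π (S.twist s x a) (ξ (s * x)) := rfl

theorem norm_regularOp_le (x : G) (a : A) : ‖S.regularOp π x a‖ ≤ ‖a‖ := by
  refine (ContinuousLinearMap.opNorm_comp_le _ _).trans ?_
  refine (mul_le_mul (lp.norm_mapCLM_le ..) (LinearIsometry.norm_toContinuousLinearMap_le _)
    (norm_nonneg _) (norm_nonneg _)).trans_eq (mul_one _)

theorem norm_apply_le_norm_regularOp (x : G) (a : A) {v : H} (hv : ‖v‖ = 1) :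
    ‖π a v‖ ≤ ‖S.regularOp π x a‖ := by
  classical
  calc ‖π a v‖ = ‖S.regularOp π x a (lp.single 2 x v) 1‖ := by
        rw [regularOp_apply, one_mul, lp.single_apply_self, twist_one]
    _ ≤ ‖S.regularOp π x a (lp.single 2 x v)‖ := lp.norm_apply_le_norm (by simp) _ 1
    _ ≤ ‖S.regularOp π x a‖ := (S.regularOp π x a).unit_le_opNorm _ <| by
        rw [lp.norm_single (by simp), hv]

theorem regularOp_add (x : G) (a b : A) :
    S.regularOp π x (a + b) = S.regularOp π x a + S.regularOp π x b := by
  ext ξ s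
  simp [regularOp_apply]

theorem regularOp_smul (x : G) (c : ℂ) (a : A) :
    S.regularOp π x (c • a) = c • S.regularOp π x a := by
  ext ξ s
  simp [regularOp_apply]

theorem regularOp_mul (x z : G) (a b : A) : S.regularOp π x a * S.regularOp π z b =
    S.regularOp π (x * z) ((S.ω x z : 𝓜(ℂ, A)).snd (a * S.α x b)) := by
  ext ξ s
  rw [mul_apply_eq_comp, regularOp_apply, regularOp_apply, regularOp_apply,
    ← S.twist_mul, map_mul, mul_assoc]
  rfl

theorem star_regularOp (x : G) (a : A) : star (S.regularOp π x⁻¹ a) =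
    S.regularOp π x ((star (S.ω x x⁻¹ : 𝓜(ℂ, A))).fst (star (S.α x a))) := by
  symm
  rw [ContinuousLinearMap.star_eq_adjoint, ContinuousLinearMap.eq_adjoint_iff]
  intro ξ η
  rw [lp.inner_eq_tsum, lp.inner_eq_tsum]
  refine Eq.trans (tsum_congr fun s => ?_) ((Equiv.mulRight x).tsum_eq
    fun t => inner ℂ (ξ t) (S.regularOp π x⁻¹ a η t))
  rw [regularOp_apply, ← S.star_twist, map_star, ContinuousLinearMap.star_eq_adjoint,
    ContinuousLinearMap.adjoint_inner_left, regularOp_apply, Equiv.coe_mulRight,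
    mul_inv_cancel_right]

end Representation

/-- An isometric covariant family of linear maps `R x : A → C`: the products and adjoints of the
`R x a` are those of the elementary functions `a δ_x` of the twisted crossed product. Such a family
untwists the crossed product, since it maps it into `ℓ¹(G; C)`. -/
structure IsometricFamily (S : TwistedCStarSystem G A) (C : Type*) [NonUnitalCStarAlgebra C] where
  R : G → A →ₗᵢ[ℂ] C
  R_mul : ∀ x z a b, R x a * R z b = R (x * z) ((S.ω x z : 𝓜(ℂ, A)).snd (a * S.α x b))
  R_star : ∀ x a, star (R x⁻¹ a) = R x ((star (S.ω x x⁻¹ : 𝓜(ℂ, A))).fst (star (S.α x a)))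

namespace IsometricFamily

variable {S} {C : Type*} [NonUnitalCStarAlgebra C] (F : IsometricFamily S C)

/-- The `*`-homomorphism `f ↦ (x ↦ R x (f x))` into the untwisted, unweighted `ℓ¹`-algebra given by
an isometric covariant family. -/
noncomputable def hom (ν : SymmWeight G) : TwistedCrossedProduct S ν →⋆ₙₐ[ℂ]
    TwistedCrossedProduct (TwistedCStarSystem.trivial G C) (SymmWeight.trivial G) where
  toFun f := ⟨fun x => F.R x (f x), by
    refine f.summable_norm.congr fun x => ?_
    change _ = 1 * ‖F.R x (f x)‖
    rw [one_mul, LinearIsometry.norm_map]⟩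
  map_smul' c f := TwistedCrossedProduct.ext fun x => map_smul (F.R x) c (f x)
  map_zero' := TwistedCrossedProduct.ext fun x => map_zero (F.R x)
  map_add' f g := TwistedCrossedProduct.ext fun x => map_add (F.R x) (f x) (g x)
  map_mul' f g := TwistedCrossedProduct.ext fun x => by
    change F.R x ((f * g) x) = _
    rw [TwistedCrossedProduct.mul_apply, TwistedCrossedProduct.mul_apply]
    refine ((F.R x).toContinuousLinearMap.map_tsum
      (TwistedCrossedProduct.summable_convTerm f g x)).trans (tsum_congr fun y => ?_)
    have hmul := F.R_mul y (y⁻¹ * x) (f y) (g (y⁻¹ * x))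
    rw [mul_inv_cancel_left] at hmul
    exact hmul.symm
  map_star' f := TwistedCrossedProduct.ext fun x => by
    rw [TwistedCrossedProduct.star_apply]
    change F.R x ((star f) x) = (star (1 : 𝓜(ℂ, C))).fst (star (F.R x⁻¹ (f x⁻¹)))
    rw [star_one, F.R_star, TwistedCrossedProduct.star_apply]
    rfl

theorem norm_hom {ν : SymmWeight G} (k : TwistedCrossedProduct S ν) :
    ‖F.hom ν k‖ = ∑' x, ‖k x‖ := by
  rw [TwistedCrossedProduct.norm_def]
  refine tsum_congr fun x => ?_
  change 1 * ‖F.R x (k x)‖ = _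
  rw [one_mul, LinearIsometry.norm_map]

end IsometricFamily

section Product

variable {ι : Type*} {H : ι → Type*} [∀ i, NormedAddCommGroup (H i)]
  [∀ i, InnerProductSpace ℂ (H i)] [∀ i, CompleteSpace (H i)]
  (π : ∀ i, A →⋆ₙₐ[ℂ] (H i →L[ℂ] H i))

/-- The C*-algebra of bounded families of operators on the spaces `ℓ²(G; H i)`. -/
abbrev OperatorProduct (G : Type*) {ι : Type*} (H : ι → Type*) [∀ i, NormedAddCommGroup (H i)]
    [∀ i, InnerProductSpace ℂ (H i)] : Type _ :=
  lp (fun i => lp (fun _ : G => H i) 2 →L[ℂ] lp (fun _ : G => H i) 2) ∞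

/-- The family of the operators `regularOp` over a family of representations. -/
noncomputable def regular (x : G) : A →ₗ[ℂ] OperatorProduct G H where
  toFun a := ⟨fun i => S.regularOp (π i) x a, memℓp_infty ⟨‖a‖, by
    rintro _ ⟨i, rfl⟩
    exact S.norm_regularOp_le (π i) x a⟩⟩
  map_add' a b := lp.ext (funext fun i => S.regularOp_add (π i) x a b)
  map_smul' c a := lp.ext (funext fun i => S.regularOp_smul (π i) x c a)

theorem norm_regular (hπ : ∀ a, ∃ i, ∃ v : H i, ‖v‖ = 1 ∧ ‖π i a v‖ = ‖a‖)
    (x : G) (a : A) : ‖S.regular π x a‖ = ‖a‖ := by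
  refine le_antisymm (lp.norm_le_of_forall_le (norm_nonneg a)
    fun i => S.norm_regularOp_le (π i) x a) ?_
  obtain ⟨i, v, hv, h⟩ := hπ a
  rw [← h]
  exact (S.norm_apply_le_norm_regularOp (π i) x a hv).trans
    (lp.norm_apply_le_norm ENNReal.top_ne_zero (S.regular π x a) i)

/-- The regular representations induced from a norm-attaining family of representations. -/
noncomputable def regularFamily (hπ : ∀ a, ∃ i, ∃ v : H i, ‖v‖ = 1 ∧ ‖π i a v‖ = ‖a‖) :
    IsometricFamily S (OperatorProduct G H) where
  R x := ⟨S.regular π x, S.norm_regular π hπ x⟩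
  R_mul x z a b := lp.ext (funext fun i => S.regularOp_mul (π i) x z a b)
  R_star x a := lp.ext (funext fun i => S.star_regularOp (π i) x a)

end Product

theorem exists_isometricFamily_of_representations {G : Type u} [Group G] {A : Type v}
    [NonUnitalCStarAlgebra A] (S : TwistedCStarSystem G A) {ι : Type v} {H : ι → Type v}
    [∀ i, NormedAddCommGroup (H i)] [∀ i, InnerProductSpace ℂ (H i)] [∀ i, CompleteSpace (H i)]
    (π : ∀ i, A →⋆ₙₐ[ℂ] (H i →L[ℂ] H i))
    (hπ : ∀ a, ∃ i, ∃ v : H i, ‖v‖ = 1 ∧ ‖π i a v‖ = ‖a‖) :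
    ∃ (C : Type (max u v)) (_ : NonUnitalCStarAlgebra C), Nonempty (IsometricFamily S C) :=
  ⟨OperatorProduct G H, inferInstance, ⟨S.regularFamily π hπ⟩⟩

theorem exists_isometricFamily {G : Type u} [Group G] {A : Type v} [NonUnitalCStarAlgebra A]
    (S : TwistedCStarSystem G A) :
    ∃ (C : Type (max u v)) (_ : NonUnitalCStarAlgebra C), Nonempty (IsometricFamily S C) := by
  let _ := CStarAlgebra.spectralOrder (Unitization ℂ A)
  have _ := CStarAlgebra.spectralOrderedRing (Unitization ℂ A)
  open scoped ComplexOrder in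
  let π : ∀ φ : Unitization ℂ A →ₚ[ℂ] ℂ, A →⋆ₙₐ[ℂ] (φ.GNS →L[ℂ] φ.GNS) := fun φ =>
    φ.gnsNonUnitalStarAlgHom.comp (Unitization.inrNonUnitalStarAlgHom ℂ A)
  have hπ : ∀ a, ∃ φ, ∃ v, ‖v‖ = 1 ∧ ‖π φ a v‖ = ‖a‖ := fun a => by
    obtain ⟨φ, v, hv, h⟩ := exists_gns_norm_apply_eq (a : Unitization ℂ A)
    exact ⟨φ, v, hv, h.trans (Unitization.norm_inr ..)⟩
  exact S.exists_isometricFamily_of_representations π hπ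

end TwistedCStarSystem

theorem mainTheorem8_general {G : Type u} [Group G] (hrig : IsRigidlySymmetric.{u, max u v} G)
    {ν : SymmWeight G} (hν : ν.HasSubexponentialWordBound) {A : Type v} [NonUnitalCStarAlgebra A]
    (S : TwistedCStarSystem G A) : IsSymmetricBanachStarAlgebra (TwistedCrossedProduct S ν) := by
  obtain ⟨C, _, ⟨F⟩⟩ := S.exists_isometricFamily
  refine (hrig C).of_hom (F.hom ν) fun k z hz => ?_
  rw [F.norm_hom]
  exact TwistedCrossedProduct.norm_le_tsum_norm_of_mem_quasispectrum hν hz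

theorem mainTheorem8 {G : Type u} [Group G]
    (hrig : IsRigidlySymmetric.{u, max u v} G) (hamen : IsAmenableGroup G)
    (ν : SymmWeight G) (V : Set G) (hone : (1 : G) ∈ V)
    (hgen : (⋃ n : ℕ, V ^ n) = Set.univ)
    (hugrs : Tendsto (fun n : ℕ => (⨆ x ∈ V ^ n, ENNReal.ofReal (ν x)) ^ (1 / (n : ℝ)))
      atTop (𝓝 1))
    (hcomp : ∃ C : ℝ≥0, ∀ n : ℕ,
      (⨆ x ∈ V ^ (n + 1) \ V ^ n, ENNReal.ofReal (ν x)) ≤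
        (C : ℝ≥0∞) * ⨅ x ∈ V ^ (n + 1) \ V ^ n, ENNReal.ofReal (ν x))
    {A : Type v} [NonUnitalCStarAlgebra A] (S : TwistedCStarSystem G A) :
    IsSymmetricBanachStarAlgebra (TwistedCrossedProduct S ν) :=
  mainTheorem8_general hrig (SymmWeight.hasSubexponentialWordBound hone hgen hugrs hcomp) S
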